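/- **Theorem.** For a rational function $P\in\mathbb{C}(x_1,\dots,x_k)$ let $$m(P)=\int_0^1\!\cdots\!\int_0^1\log\left|P(e^{2\pi i\theta_1},\dots,e^{2\pi i\theta_k})\right|\,d\theta_1\cdots d\theta_k$$ be its logarithmic Mahler measure, and let $$\mathcal{L}_3(x)=\mathrm{Re}\left(\mathrm{Li}_3(x)-\log|x|\,\mathrm{Li}_2(x)+\tfrac13\log^2|x|\,\mathrm{Li}_1(x)\right)$$ be Zagier's single-valued trilogarithm, where $\mathrm{Li}_n$ is the analytic continuation of $\sum_{k\ge1}x^k/k^n$ to $\mathbb{C}\setminus[1,\infty)$, with values on the cut $(1,\infty)$ obtained as one-sided limits (the real part does not depend on the side). Let $m,n\ge1$ be integers. Then the equation $t^{m+n}+t^n-1=0$ has exactly one root $\phi_1$ in $[0,1]$, the equation $t^{m+n}-t^n-1=0$ has exactly one root $\phi_2$ in $[1,\infty)$, the integral defining the following Mahler measure in the three variables $x,y,z$ converges absolutely, and $$m\left(z-\frac{(1-x)^m(1-y)^n}{(1-xy)^{m+n}}\right)=\frac{2n}{\pi^2}\left(\mathcal{L}_3(\phi_2^m)-\mathcal{L}_3(-\phi_1^m)\right)+\frac{2m}{\pi^2}\left(\mathcal{L}_3(\phi_1^n)-\mathcal{L}_3(-\phi_2^n)\right).$$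 -/

import Mathlib

/-- The polylogarithm `Li_n(z)`, `n ≥ 1`, on the whole complex plane:
`Li_1(z) = -log(1 - z)` and `Li_{n+1}(z) = ∫_0^z Li_n(w) dw / w`, the integral being taken along
the straight segment from `0` to `z`. On `ℂ \ [1, ∞)` this is the analytic continuation of
`∑ z ^ k / k ^ n` (see `polylog_hasSum`); on the cut `(1, ∞)` it is the limit from below, by the
convention for the principal logarithm of a negative number.
For completeness, `Li_0(z) = z / (1 - z)`. -/
noncomputable def polylog : ℕ → ℂ → ℂ
  | 0, z => z / (1 - z)
  | 1, z => -Complex.log (1 - z)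
  | n + 2, z => ∫ t in (0 : ℝ)..1, polylog (n + 1) ((t : ℂ) * z) / (t : ℂ)

/-- The polylogarithm is given by its usual power series on the open unit disc. -/
theorem polylog_hasSum (n : ℕ) (z : ℂ) (hz : ‖z‖ < 1) :
    HasSum (fun k : ℕ => z ^ (k + 1) / ((k : ℂ) + 1) ^ (n + 1)) (polylog (n + 1) z) := by
  induction n generalizing z with
  | zero =>
    have h := Complex.hasSum_taylorSeries_neg_log hz
    rw [← hasSum_nat_add_iff' 1] at h
    simpa [polylog] using h
  | succ n ih =>
    have key : HasSum
        (fun k : ℕ => ∫ t in (0 : ℝ)..1, z ^ (k + 1) / ((k : ℂ) + 1) ^ (n + 1) * (t : ℂ) ^ k)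
        (∫ t in (0 : ℝ)..1, polylog (n + 1) ((t : ℂ) * z) / (t : ℂ)) := by
      apply intervalIntegral.hasSum_integral_of_dominated_convergence
        (fun k _ => ‖z‖ ^ k)
      · intro k
        apply Continuous.aestronglyMeasurable
        fun_prop
      · intro k
        refine Filter.Eventually.of_forall fun t ht => ?_
        rw [Set.uIoc_of_le zero_le_one] at ht
        rw [norm_mul, norm_div, norm_pow, norm_pow, norm_pow]
        have h1 : (1 : ℝ) ≤ ‖((k : ℂ) + 1)‖ := by
          have : ((k : ℂ) + 1) = ((k + 1 : ℕ) : ℂ) := by push_cast; ring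
          rw [this, Complex.norm_natCast]
          exact_mod_cast Nat.succ_le_succ (Nat.zero_le k)
        have h2 : ‖z‖ ^ (k + 1) / ‖((k : ℂ) + 1)‖ ^ (n + 1) ≤ ‖z‖ ^ (k + 1) :=
          div_le_self (by positivity) (one_le_pow₀ h1)
        have h3 : ‖(t : ℂ)‖ ^ k ≤ 1 := by
          apply pow_le_one₀ (norm_nonneg _)
          rw [Complex.norm_real, Real.norm_eq_abs, abs_of_pos ht.1]
          exact ht.2
        have h4 : ‖z‖ ^ (k + 1) ≤ ‖z‖ ^ k :=
          pow_le_pow_of_le_one (norm_nonneg _) hz.le (Nat.le_succ k)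
        calc _ ≤ ‖z‖ ^ (k + 1) * 1 := by gcongr
          _ ≤ _ := by simpa using h4
      · exact Filter.Eventually.of_forall fun t _ =>
          summable_geometric_of_lt_one (norm_nonneg _) hz
      · exact intervalIntegrable_const
      · refine Filter.Eventually.of_forall fun t ht => ?_
        rw [Set.uIoc_of_le zero_le_one] at ht
        have ht0 : (t : ℂ) ≠ 0 := by exact_mod_cast ht.1.ne'
        have hn : ‖(t : ℂ) * z‖ < 1 := by
          rw [norm_mul, Complex.norm_real, Real.norm_eq_abs, abs_of_pos ht.1]
          exact lt_of_le_of_lt (mul_le_of_le_one_left (norm_nonneg _) ht.2) hz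
        have heq : (fun k : ℕ => z ^ (k + 1) / ((k : ℂ) + 1) ^ (n + 1) * (t : ℂ) ^ k)
            = fun k : ℕ => ((t : ℂ) * z) ^ (k + 1) / ((k : ℂ) + 1) ^ (n + 1) / (t : ℂ) := by
          funext k
          rw [mul_pow, pow_succ (t : ℂ)]
          field_simp
        rw [heq]
        exact (ih _ hn).div_const (t : ℂ)
    have hv : ∀ k : ℕ,
        (∫ t in (0 : ℝ)..1, z ^ (k + 1) / ((k : ℂ) + 1) ^ (n + 1) * (t : ℂ) ^ k)
          = z ^ (k + 1) / ((k : ℂ) + 1) ^ (n + 1 + 1) := by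
      intro k
      rw [intervalIntegral.integral_const_mul]
      have h : (∫ t in (0 : ℝ)..1, (t : ℂ) ^ k) = 1 / ((k : ℂ) + 1) := by
        have : (∫ t in (0 : ℝ)..1, (t : ℂ) ^ k) = ∫ t in (0 : ℝ)..1, ((t ^ k : ℝ) : ℂ) := by
          simp
        rw [this, intervalIntegral.integral_ofReal, integral_pow]
        simp
      rw [h, pow_succ _ (n + 1), div_mul_div_comm, mul_one]
    simpa only [hv, polylog] using key

/-- Zagier's single-valued polylogarithm
`𝓛_n(x) = Re_n (∑_{j < n} (2 ^ j B_j / j!) (log |x|) ^ j Li_{n-j}(x))`,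
where `Re_n` is the real part for odd `n` and the imaginary part for even `n`, and `B_j` is the
`j`-th Bernoulli number (`B_1 = -1/2`). -/
noncomputable def zagierL (n : ℕ) (x : ℂ) : ℝ :=
  let s : ℂ := ∑ j ∈ Finset.range n,
    (2 ^ j * ((bernoulli j : ℚ) : ℂ) / (j.factorial : ℂ)) * ((Real.log ‖x‖ : ℝ) : ℂ) ^ j
      * polylog (n - j) x
  if Odd n then s.re else s.im

/-- `𝓛_3(x) = Re (Li_3(x) - log |x| Li_2(x) + (1/3) log² |x| Li_1(x))`. -/
theorem zagierL_three (x : ℂ) :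
    zagierL 3 x = (polylog 3 x - (Real.log ‖x‖ : ℝ) * polylog 2 x
      + 1 / 3 * ((Real.log ‖x‖ : ℝ) : ℂ) ^ 2 * polylog 1 x).re := by
  have h2 : bernoulli 2 = 1 / 6 := by
    rw [bernoulli_eq_bernoulli'_of_ne_one (by norm_num), bernoulli'_two]
  have h3 : Odd 3 := by decide
  simp only [zagierL, if_pos h3, Finset.sum_range_succ, Finset.sum_range_zero, bernoulli_zero,
    bernoulli_one, h2]
  congr 1
  push_cast [Nat.factorial]
  ring

/-- The function `log |P(e^{2πiθ_1}, …, e^{2πiθ_k})|` of `θ ∈ ℝ^k`. -/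
noncomputable def logAbsOnTorus {k : ℕ} (P : (Fin k → ℂ) → ℂ) (θ : Fin k → ℝ) : ℝ :=
  Real.log ‖P fun i => Complex.exp (2 * Real.pi * Complex.I * (θ i : ℂ))‖

/-- The logarithmic Mahler measure
`m(P) = ∫_{[0,1]^k} log |P(e^{2πiθ_1}, …, e^{2πiθ_k})| dθ_1 ⋯ dθ_k`
of a rational function `P` in `k` variables. -/
noncomputable def logMahler {k : ℕ} (P : (Fin k → ℂ) → ℂ) : ℝ :=
  ∫ θ in Set.Icc (0 : Fin k → ℝ) 1, logAbsOnTorus P θ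

/-- The rational function `z - (1 - x)^m (1 - y)^n / (1 - x y)^(m + n)`, where
`(x, y, z) = (v 0, v 1, v 2)`. -/
noncomputable def resFun (m n : ℕ) (v : Fin 3 → ℂ) : ℂ :=
  v 2 - (1 - v 0) ^ m * (1 - v 1) ^ n / (1 - v 0 * v 1) ^ (m + n)

/-! Jensen's formula in `z` turns the Mahler measure into the integral of `log⁺ |Q|` over the unit
square, where `Q` is the quotient in `x` and `y` (`logAbsOnTorus_resFun_integral`). Since `|1 -
e^{2πiu}| = 2 |sin πu|` and the powers of 2 cancel, `|Q| = |sin πa|^m |sin πb|^n / |sin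
π(a+b)|^(m+n)`. The reflection `(a, b) ↦ (1-a, 1-b)` leaves only the half `a + b < 1`, where `πa`,
`πb` are two angles of a Euclidean triangle. By the law of sines `log |Q| = nX + mY`, with `1`,
`e^X`, `e^Y` the sides of that triangle.

The map from angles to `(X, Y)` is a bijection onto the amoeba of a line, with Jacobian of constant
modulus `π²` (`lintegral_angleTriangle`). So the measure is `2/π²` times the integral of the
positive part of `nX + mY` over the amoeba (`lintegral_posLog_torusQuotient`). The diagonal cuts
this region into two sectors (`lintegral_lineAmoeba`).

A sector is swept by segments from the origin to the curve `e^X = 1 + e^Y`. In the coordinates `(r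
s(y), r y)` with `s(y) = log (1 + e^y)`, the linear form and the Jacobian each contribute a factor
`r`. The radial integral is therefore `1/3`, and what remains is the integral of `(αs + βy)(s -
ys')`, which has an explicit primitive in `𝓛_3` (`hasDerivAt_sectorPrimitive`). The primitive
vanishes at infinity by the inversion `𝓛_3(1/x) = 𝓛_3(x)`. At the other end `αs + βy = 0`, which is
the equation of `φ₂` in one sector and of `φ₁` in the other (`lintegral_amoebaSector`). -/

open MeasureTheory Filter Topology

/-! ### Real parts of `Li_2` and `Li_3` on the real line. -/

/-- The function `-log |1 - t| / t`, extended continuously to `t = 0`. -/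
noncomputable def dilogKernel (t : ℝ) : ℝ :=
  -Real.log (1 - t) - dslope (fun s : ℝ => (1 - s) * Real.log (1 - s)) 0 t

lemma hasDerivAt_log_one_sub {t : ℝ} (ht : t ≠ 1) :
    HasDerivAt (fun s : ℝ => Real.log (1 - s)) (-1 / (1 - t)) t := by
  have h : HasDerivAt (fun s : ℝ => 1 - s) (-1) t := by
    simpa using (hasDerivAt_id t).const_sub 1
  exact h.log (sub_ne_zero.2 ht.symm)

lemma hasDerivAt_one_sub_mul_log :
    HasDerivAt (fun s : ℝ => (1 - s) * Real.log (1 - s)) (-1) 0 := by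
  have h : HasDerivAt (fun s : ℝ => 1 - s) (-1) 0 := by
    simpa using (hasDerivAt_id (0 : ℝ)).const_sub 1
  have := h.fun_mul (hasDerivAt_log_one_sub (t := 0) (by norm_num))
  simpa using this

lemma continuous_dslope_of_differentiableAt {f : ℝ → ℝ} {a : ℝ} (hf : Continuous f)
    (hd : DifferentiableAt ℝ f a) : Continuous (dslope f a) := by
  rw [← continuousOn_univ, continuousOn_dslope univ_mem]
  exact ⟨hf.continuousOn, hd⟩

lemma continuous_one_sub_mul_log : Continuous fun s : ℝ => (1 - s) * Real.log (1 - s) :=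
  Real.continuous_mul_log.comp (continuous_const.sub continuous_id)

lemma continuous_dslope_one_sub_mul_log :
    Continuous (dslope (fun s : ℝ => (1 - s) * Real.log (1 - s)) 0) :=
  continuous_dslope_of_differentiableAt continuous_one_sub_mul_log
    hasDerivAt_one_sub_mul_log.differentiableAt

lemma mul_dilogKernel (t : ℝ) : t * dilogKernel t = -Real.log (1 - t) := by
  rcases eq_or_ne t 0 with rfl | ht
  · simp
  · rw [dilogKernel, dslope_of_ne _ ht, slope_def_field]
    simp only [sub_zero, Real.log_one, mul_zero]
    field_simp
    ring

lemma dilogKernel_eq {t : ℝ} (ht : t ≠ 0) : dilogKernel t = -Real.log (1 - t) / t := by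
  rw [eq_div_iff ht, mul_comm, mul_dilogKernel]

/-- This is the purpose of the splitting in `dilogKernel`: the singularity at `1` sits in a bare
logarithm, and the removable one at `0` in a continuous slope. -/
lemma intervalIntegrable_dilogKernel (a b : ℝ) : IntervalIntegrable dilogKernel volume a b := by
  have h : IntervalIntegrable (fun t : ℝ => Real.log (1 - t)) volume a b := by
    have := (intervalIntegral.intervalIntegrable_log' (a := 1 - a) (b := 1 - b)).comp_sub_left 1
    simpa using this
  exact h.neg.sub (continuous_dslope_one_sub_mul_log.intervalIntegrable a b)

lemma continuousAt_dilogKernel {t : ℝ} (ht : t ≠ 1) : ContinuousAt dilogKernel t :=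
  (hasDerivAt_log_one_sub ht).continuousAt.neg.sub continuous_dslope_one_sub_mul_log.continuousAt

lemma measurable_dilogKernel : Measurable dilogKernel := by
  unfold dilogKernel
  have := continuous_dslope_one_sub_mul_log.measurable
  fun_prop

/-- The real part of the dilogarithm on the real line. -/
noncomputable def reDilog (x : ℝ) : ℝ := ∫ t in (0 : ℝ)..x, dilogKernel t

lemma continuous_reDilog : Continuous reDilog :=
  intervalIntegral.continuous_primitive intervalIntegrable_dilogKernel 0

lemma hasDerivAt_reDilog {x : ℝ} (hx : x ≠ 1) : HasDerivAt reDilog (dilogKernel x) x :=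
  intervalIntegral.integral_hasDerivAt_right (intervalIntegrable_dilogKernel 0 x)
    measurable_dilogKernel.stronglyMeasurable.stronglyMeasurableAtFilter
    (continuousAt_dilogKernel hx)

lemma reDilog_zero : reDilog 0 = 0 := by simp [reDilog]

lemma continuous_dslope_reDilog : Continuous (dslope reDilog 0) :=
  continuous_dslope_of_differentiableAt continuous_reDilog
    (hasDerivAt_reDilog zero_ne_one).differentiableAt

lemma mul_dslope_reDilog (x : ℝ) : x * dslope reDilog 0 x = reDilog x := by
  have := sub_smul_dslope reDilog 0 x
  simpa [reDilog_zero] using this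

/-- The real part of the trilogarithm on the real line. -/
noncomputable def reTrilog (x : ℝ) : ℝ := ∫ t in (0 : ℝ)..x, dslope reDilog 0 t

lemma hasDerivAt_reTrilog (x : ℝ) : HasDerivAt reTrilog (dslope reDilog 0 x) x :=
  continuous_dslope_reDilog.integral_hasStrictDerivAt 0 x |>.hasDerivAt

lemma continuous_reTrilog : Continuous reTrilog :=
  continuous_iff_continuousAt.2 fun x => (hasDerivAt_reTrilog x).continuousAt

lemma reTrilog_zero : reTrilog 0 = 0 := by simp [reTrilog]

/-- Taking real parts under the integral requires `f` itself to be integrable; for the imaginary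
part a bound suffices. -/
lemma re_integral_of_bounded_im {f : ℝ → ℂ} {g : ℝ → ℝ} {C : ℝ} (hf : Measurable f)
    (hg : IntervalIntegrable g volume 0 1) (hre : ∀ t, 0 < t → (f t).re = g t)
    (him : ∀ t, 0 < t → |(f t).im| ≤ C) :
    (∫ t in (0 : ℝ)..1, f t).re = ∫ t in (0 : ℝ)..1, g t := by
  have hint : IntervalIntegrable f volume 0 1 := by
    rw [intervalIntegrable_iff_integrableOn_Ioc_of_le zero_le_one] at hg ⊢
    refine Integrable.re_im_iff.1 ⟨?_, ?_⟩
    · refine hg.congr_fun (fun t ht => ?_) measurableSet_Ioc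
      exact (hre t ht.1).symm
    · refine Measure.integrableOn_of_bounded (M := C) (by simp) ?_ ?_
      · exact (Complex.measurable_im.comp hf).aestronglyMeasurable
      · exact (ae_restrict_iff' measurableSet_Ioc).2 (.of_forall fun t ht => him t ht.1)
  have := Complex.reCLM.intervalIntegral_comp_comm hint
  rw [Complex.reCLM_apply] at this
  rw [← this]
  refine intervalIntegral.integral_congr_ae (.of_forall fun t ht => ?_)
  rw [Set.uIoc_of_le zero_le_one] at ht
  exact hre t ht.1

lemma ofReal_one_sub_mul (t x : ℝ) : 1 - (t : ℂ) * (x : ℂ) = ((1 - t * x : ℝ) : ℂ) := by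
  push_cast; rfl

lemma polylog_one_re (x : ℝ) : (polylog 1 (x : ℂ)).re = -Real.log (1 - x) := by
  have h : (1 : ℂ) - (x : ℂ) = ((1 - x : ℝ) : ℂ) := by push_cast; rfl
  rw [polylog, h, Complex.neg_re, Complex.log_re, Complex.norm_real, Real.norm_eq_abs,
    Real.log_abs]

/-- The argument is zero until `t * x` passes `1`; from there on it is at most `π`, and `1 ≤ |x| *
t` pays for the division by `t`. -/
lemma abs_polylog_one_im_le (x t : ℝ) (ht : 0 < t) :
    |(polylog 1 ((t : ℂ) * x) / (t : ℂ)).im| ≤ Real.pi * |x| := by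
  rw [Complex.div_ofReal_im, polylog, ofReal_one_sub_mul, Complex.neg_im, Complex.log_im, abs_div,
    abs_neg, abs_of_pos ht, div_le_iff₀ ht]
  rcases le_or_gt 0 (1 - t * x) with h | h
  · rw [Complex.arg_ofReal_of_nonneg h]
    rw [abs_zero]
    positivity
  · have h1 : 1 ≤ |x| * t := by
      have := le_abs_self x
      nlinarith
    calc _ ≤ Real.pi := Complex.abs_arg_le_pi _
      _ ≤ Real.pi * (|x| * t) := le_mul_of_one_le_right Real.pi_pos.le h1
      _ = _ := by ring

lemma integral_comp_mul_right_zero_one {f : ℝ → ℝ} (x : ℝ) :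
    ∫ t in (0 : ℝ)..1, x * f (t * x) = ∫ t in (0 : ℝ)..x, f t := by
  rw [intervalIntegral.integral_const_mul]
  simp

lemma measurable_polylog_one_kernel :
    Measurable fun p : ℝ × ℝ => polylog 1 ((p.2 : ℂ) * (p.1 : ℂ)) / (p.2 : ℂ) := by
  simp only [polylog]
  fun_prop

lemma polylog_two_eq (z : ℂ) :
    polylog 2 z = ∫ t in (0 : ℝ)..1, polylog 1 ((t : ℂ) * z) / (t : ℂ) := by
  rw [polylog]

lemma polylog_three_eq (z : ℂ) :
    polylog 3 z = ∫ t in (0 : ℝ)..1, polylog 2 ((t : ℂ) * z) / (t : ℂ) := by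
  rw [polylog]

lemma polylog_two_re (x : ℝ) : (polylog 2 (x : ℂ)).re = reDilog x := by
  rw [polylog_two_eq, reDilog, ← integral_comp_mul_right_zero_one x]
  have hm : Measurable fun t : ℝ => polylog 1 ((t : ℂ) * x) / (t : ℂ) := by
    simp only [polylog]
    fun_prop
  refine re_integral_of_bounded_im hm ?_ ?_ (abs_polylog_one_im_le x)
  · refine IntervalIntegrable.const_mul ?_ _
    rcases eq_or_ne x 0 with rfl | hx
    · simp
    · have := (intervalIntegrable_dilogKernel 0 x).comp_mul_right (c := x)
      simpa [hx] using this
  · intro t ht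
    rw [Complex.div_ofReal_re, ← Complex.ofReal_mul, polylog_one_re, div_eq_iff ht.ne',
      ← mul_dilogKernel]
    ring

lemma abs_polylog_two_im_le (x : ℝ) : |(polylog 2 (x : ℂ)).im| ≤ Real.pi * |x| := by
  rw [polylog_two_eq]
  -- Without integrability the integral is `0` by convention, so the bound holds in either case.
  by_cases hint : IntervalIntegrable
      (fun t : ℝ => polylog 1 ((t : ℂ) * x) / (t : ℂ)) volume 0 1
  · have := Complex.imCLM.intervalIntegral_comp_comm hint
    rw [Complex.imCLM_apply] at this
    rw [← this]
    have h := intervalIntegral.norm_integral_le_of_norm_le_const (a := 0) (b := 1)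
      (C := Real.pi * |x|)
      (f := fun t : ℝ => Complex.imCLM (polylog 1 ((t : ℂ) * x) / (t : ℂ))) fun t ht => by
        rw [Set.uIoc_of_le zero_le_one] at ht
        exact abs_polylog_one_im_le x t ht.1
    simpa using h
  · rw [intervalIntegral.integral_undef hint]
    simpa using mul_nonneg Real.pi_pos.le (abs_nonneg x)

lemma measurable_polylog_two_ofReal : Measurable fun x : ℝ => polylog 2 (x : ℂ) := by
  simp only [polylog_two_eq, intervalIntegral.integral_of_le zero_le_one]
  exact (StronglyMeasurable.integral_prod_right (ν := volume.restrict (Set.Ioc (0 : ℝ) 1))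
    (f := fun x t : ℝ => polylog 1 ((t : ℂ) * (x : ℂ)) / (t : ℂ))
    measurable_polylog_one_kernel.stronglyMeasurable).measurable

lemma polylog_three_re (x : ℝ) : (polylog 3 (x : ℂ)).re = reTrilog x := by
  rw [polylog_three_eq, reTrilog, ← integral_comp_mul_right_zero_one x]
  refine re_integral_of_bounded_im (C := Real.pi * |x|) ?_ ?_ ?_ ?_
  · have := measurable_polylog_two_ofReal.comp (measurable_id.mul_const x)
    refine Measurable.div ?_ (by fun_prop)
    simpa [Function.comp_def] using this
  · refine Continuous.intervalIntegrable ?_ _ _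
    have := continuous_dslope_reDilog
    fun_prop
  · intro t ht
    rw [← Complex.ofReal_mul, Complex.div_ofReal_re, polylog_two_re, div_eq_iff ht.ne',
      ← mul_dslope_reDilog]
    ring
  · intro t ht
    rw [← Complex.ofReal_mul, Complex.div_ofReal_im, abs_div, abs_of_pos ht, div_le_iff₀ ht]
    refine (abs_polylog_two_im_le _).trans_eq ?_
    rw [abs_mul, abs_of_pos ht]
    ring

lemma zagierL_three_ofReal (x : ℝ) :
    zagierL 3 (x : ℂ) =
      reTrilog x - Real.log x * reDilog x - 1 / 3 * Real.log x ^ 2 * Real.log (1 - x) := by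
  rw [zagierL_three]
  have h : ((1 : ℂ) / 3 * ((Real.log ‖(x : ℂ)‖ : ℝ) : ℂ) ^ 2) =
      ((1 / 3 * Real.log x ^ 2 : ℝ) : ℂ) := by
    rw [Complex.norm_real, Real.norm_eq_abs, Real.log_abs]
    push_cast; rfl
  rw [h, Complex.add_re, Complex.sub_re, Complex.re_ofReal_mul, Complex.re_ofReal_mul,
    polylog_one_re, polylog_two_re, polylog_three_re, Complex.norm_real, Real.norm_eq_abs,
    Real.log_abs]
  ring

/-! ### `𝓛_3` of a real variable: derivative, limits, inversion. -/

/-- Zagier's trilogarithm on the real line. -/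
noncomputable def realL3 (x : ℝ) : ℝ := zagierL 3 (x : ℂ)

/-- The derivative of `Li_3` cancels the dilogarithm term produced by differentiating `log`, so only
products of logarithms survive. -/
lemma hasDerivAt_realL3 {x : ℝ} (h0 : x ≠ 0) (h1 : x ≠ 1) :
    HasDerivAt realL3
      (1 / 3 * (Real.log x * Real.log (1 - x) / x + Real.log x ^ 2 / (1 - x))) x := by
  have hfun : realL3 = fun x : ℝ =>
      reTrilog x - Real.log x * reDilog x - 1 / 3 * Real.log x ^ 2 * Real.log (1 - x) :=
    funext zagierL_three_ofReal
  rw [hfun]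
  have h1' : 1 - x ≠ 0 := sub_ne_zero.2 h1.symm
  have hl := Real.hasDerivAt_log h0
  have := ((hasDerivAt_reTrilog x).fun_sub (hl.fun_mul (hasDerivAt_reDilog h1))).fun_sub
    (((hl.fun_pow 2).const_mul (1 / 3)).fun_mul (hasDerivAt_log_one_sub h1))
  refine this.congr_deriv ?_
  have e : dslope reDilog 0 x = reDilog x / x := by
    rw [eq_div_iff h0, mul_comm, mul_dslope_reDilog]
  rw [e, dilogKernel_eq h0]
  simp only [Nat.cast_ofNat, Nat.add_one_sub_one, pow_one]
  field_simp
  ring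

/-- One factor `log x` vanishes to first order at `1` and tames the singularity of `log (1 - x)`. -/
lemma continuousAt_realL3_one : ContinuousAt realL3 1 := by
  have hfun : realL3 = fun x : ℝ => reTrilog x - Real.log x * reDilog x -
      1 / 3 * (Real.log x * dslope Real.log 1 x) * -((1 - x) * Real.log (1 - x)) := by
    funext x
    rw [realL3, zagierL_three_ofReal]
    have := sub_smul_dslope Real.log 1 x
    simp only [smul_eq_mul, Real.log_one, sub_zero] at this
    rw [sub_right_inj]
    linear_combination (-1 / 3 * Real.log (1 - x) * Real.log x) * this
  rw [hfun]
  have hl : ContinuousAt Real.log 1 := Real.continuousAt_log one_ne_zero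
  have hs : ContinuousAt (dslope Real.log 1) 1 :=
    continuousAt_dslope_same.2 (Real.differentiableAt_log one_ne_zero)
  exact (continuous_reTrilog.continuousAt.sub (hl.mul continuous_reDilog.continuousAt)).sub
    ((continuousAt_const.mul (hl.mul hs)).mul continuous_one_sub_mul_log.continuousAt.neg)

lemma tendsto_log_pow_mul_zero (n : ℕ) :
    Tendsto (fun x : ℝ => Real.log x ^ n * x) (𝓝[≠] 0) (𝓝 0) := by
  have h := (Real.isLittleO_pow_log_id_atTop (n := n)).tendsto_div_nhds_zero.comp
    ((tendsto_inv_nhdsGT_zero (𝕜 := ℝ)).comp (tendsto_abs_nhdsNE_zero (G := ℝ)))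
  rw [tendsto_zero_iff_norm_tendsto_zero] at h ⊢
  refine h.congr fun x => ?_
  simp [Real.log_inv]

lemma tendsto_realL3_zero : Tendsto realL3 (𝓝[≠] 0) (𝓝 0) := by
  have hfun : ∀ x : ℝ, reTrilog x - (Real.log x ^ 1 * x) * dslope reDilog 0 x +
      1 / 3 * (Real.log x ^ 2 * x) * dilogKernel x = realL3 x := by
    intro x
    rw [realL3, zagierL_three_ofReal, ← mul_dslope_reDilog]
    have := mul_dilogKernel x
    linear_combination (1 / 3 * Real.log x ^ 2) * this
  refine Tendsto.congr hfun ?_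
  have h1 : Tendsto reTrilog (𝓝[≠] 0) (𝓝 0) := by
    have := continuous_reTrilog.tendsto 0
    rw [reTrilog_zero] at this
    exact this.mono_left nhdsWithin_le_nhds
  have h2 := (continuous_dslope_reDilog.tendsto 0).mono_left
    (nhdsWithin_le_nhds (s := {(0 : ℝ)}ᶜ))
  have h3 := (continuousAt_dilogKernel zero_ne_one).tendsto.mono_left
    (nhdsWithin_le_nhds (s := {(0 : ℝ)}ᶜ))
  have := (h1.sub ((tendsto_log_pow_mul_zero 1).mul h2)).add
    (((tendsto_log_pow_mul_zero 2).const_mul (1 / 3)).mul h3)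
  rwa [zero_mul, mul_zero, zero_mul, sub_zero, add_zero] at this

lemma hasDerivAt_realL3_inv_sub {x : ℝ} (h0 : x ≠ 0) (h1 : x ≠ 1) :
    HasDerivAt (fun x => realL3 x⁻¹ - realL3 x) 0 x := by
  have hi : x⁻¹ ≠ 1 := by simpa using h1
  have h1' : 1 - x ≠ 0 := sub_ne_zero.2 h1.symm
  have h1'' : x - 1 ≠ 0 := sub_ne_zero.2 h1
  have := ((hasDerivAt_realL3 (inv_ne_zero h0) hi).comp x (hasDerivAt_inv h0)).fun_sub
    (hasDerivAt_realL3 h0 h1)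
  refine this.congr_deriv ?_
  have e : 1 - x⁻¹ = -(1 - x) / x := by field_simp; ring
  rw [e, Real.log_inv, Real.log_div (neg_ne_zero.2 h1') h0, Real.log_neg_eq_log]
  have e2 : -(1 - x) ≠ 0 := neg_ne_zero.2 h1'
  field_simp
  ring

/-- The difference of the two sides is constant on `[x⁻¹, 1]`, by continuity up to `1`, and it
vanishes at the fixed point `1` of inversion. -/
lemma realL3_inv_of_one_lt {x : ℝ} (hx : 1 < x) : realL3 x⁻¹ = realL3 x := by
  have hx0 : 0 < x⁻¹ := by positivity
  have hx1 : x⁻¹ ≤ 1 := inv_le_one_of_one_le₀ hx.le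
  have hcont : ContinuousOn (fun x => realL3 x⁻¹ - realL3 x) (Set.Icc x⁻¹ 1) := by
    intro y hy
    refine ContinuousAt.continuousWithinAt ?_
    rcases hy.2.eq_or_lt with rfl | h
    · refine ContinuousAt.sub ?_ continuousAt_realL3_one
      have h1 : ContinuousAt realL3 (1 : ℝ)⁻¹ := by
        simpa using continuousAt_realL3_one
      exact h1.comp (continuousAt_inv₀ one_ne_zero)
    · exact (hasDerivAt_realL3_inv_sub (by linarith [hy.1]) h.ne).continuousAt
  have := constant_of_has_deriv_right_zero hcont (fun y hy =>
    (hasDerivAt_realL3_inv_sub (by linarith [hy.1]) hy.2.ne).hasDerivWithinAt) 1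
    (Set.right_mem_Icc.2 hx1)
  simp only [inv_one, sub_self, inv_inv] at this
  linarith

/-- On the negative half-line the fixed point of inversion is `-1`. -/
lemma realL3_inv_of_neg {x : ℝ} (hx : x < 0) : realL3 x⁻¹ = realL3 x := by
  have hd : ∀ y ∈ Set.Iio (0 : ℝ), HasDerivAt (fun x => realL3 x⁻¹ - realL3 x) 0 y :=
    fun y (hy : y < 0) => hasDerivAt_realL3_inv_sub hy.ne (by linarith)
  have := IsOpen.is_const_of_deriv_eq_zero (f := fun x : ℝ => realL3 x⁻¹ - realL3 x)
    isOpen_Iio isPreconnected_Iio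
    (fun y hy => (hd y hy).differentiableAt.differentiableWithinAt)
    (fun y hy => (hd y hy).deriv) hx (show (-1 : ℝ) ∈ Set.Iio 0 by simp)
  simpa [sub_eq_zero, inv_neg] using this

/-! ### Integration over an amoeba sector along rays. -/

/-- The function `log (1 + e ^ y)`, whose graph bounds the amoeba of a line. -/
noncomputable def softplus (y : ℝ) : ℝ := Real.log (1 + Real.exp y)

lemma exp_softplus (y : ℝ) : Real.exp (softplus y) = 1 + Real.exp y :=
  Real.exp_log (by positivity)

lemma softplus_pos (y : ℝ) : 0 < softplus y :=
  Real.log_pos (by linarith [Real.exp_pos y])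

lemma lt_softplus (y : ℝ) : y < softplus y := by
  rw [← Real.exp_lt_exp, exp_softplus]
  linarith

lemma softplus_lt_softplus {x y : ℝ} (h : x < y) : softplus x < softplus y := by
  rw [← Real.exp_lt_exp, exp_softplus, exp_softplus]
  linarith [Real.exp_lt_exp.2 h]

lemma hasDerivAt_softplus (y : ℝ) :
    HasDerivAt softplus (Real.exp y / (1 + Real.exp y)) y :=
  ((Real.hasDerivAt_exp y).const_add 1).log (by positivity)

lemma measurable_softplus : Measurable softplus := by
  unfold softplus
  fun_prop

/-- Shrinking a point of the curve `e^X = 1 + e^Y` towards the origin moves it strictly to the side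
of the amoeba. Hence a ray meets the curve at most once. -/
lemma exp_mul_softplus_lt {r : ℝ} (h1 : r < 1) (y : ℝ) :
    Real.exp (r * softplus y) < 1 + Real.exp (r * y) := by
  have hX := exp_softplus y
  have e : Real.exp (r * softplus y) =
      Real.exp ((r - 1) * softplus y) + Real.exp ((r - 1) * softplus y + y) := by
    rw [Real.exp_add, ← mul_one_add, ← hX, ← Real.exp_add]
    ring_nf
  rw [e]
  refine add_lt_add (Real.exp_lt_one_iff.2 ?_) (Real.exp_lt_exp.2 ?_)
  · exact mul_neg_of_neg_of_pos (by linarith) (softplus_pos y)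
  · nlinarith [lt_softplus y]

lemma softplus_sub_mul_deriv_pos (y : ℝ) :
    0 < softplus y - y * (Real.exp y / (1 + Real.exp y)) := by
  have h1 : Real.exp y / (1 + Real.exp y) ≤ 1 :=
    (div_le_one (by positivity)).2 (by linarith [Real.exp_pos y])
  have h0 : 0 < Real.exp y / (1 + Real.exp y) := by positivity
  rcases le_or_gt y 0 with h | h
  · nlinarith [softplus_pos y]
  · nlinarith [lt_softplus y]

/-- The part of the amoeba of a line which lies between the diagonal, the curve
`e ^ X = 1 + e ^ Y` and the line `α X + β Y = 0`. -/
def amoebaSector (α β : ℝ) : Set (ℝ × ℝ) :=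
  {p | p.2 < p.1 ∧ Real.exp p.1 < 1 + Real.exp p.2 ∧ 0 < α * p.1 + β * p.2}

/-- The parametrization of an amoeba sector by rays from the origin. -/
noncomputable def rayParam (p : ℝ × ℝ) : ℝ × ℝ := (p.1 * softplus p.2, p.1 * p.2)

lemma injOn_rayParam : Set.InjOn rayParam (Set.Ioi 0 ×ˢ Set.univ) := by
  have key : ∀ r s x y : ℝ, 0 < r → r < s → r * softplus x = s * softplus y → r * x = s * y →
      False := by
    intro r s x y hr hrs h1 h2
    have hs : 0 < s := hr.trans hrs
    have h := exp_mul_softplus_lt ((div_lt_one hs).2 hrs) x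
    have e1 : r / s * softplus x = softplus y := by field_simp; linarith
    have e2 : r / s * x = y := by field_simp; linarith
    rw [e1, e2, exp_softplus] at h
    exact lt_irrefl _ h
  rintro ⟨r, x⟩ ⟨hr, -⟩ ⟨s, y⟩ ⟨hs, -⟩ h
  simp only [Set.mem_Ioi] at hr hs
  simp only [rayParam, Prod.mk.injEq] at h
  rcases lt_trichotomy r s with hrs | rfl | hrs
  · exact (key r s x y hr hrs h.1 h.2).elim
  · rw [mul_right_inj' hr.ne', mul_right_inj' hr.ne'] at h
    rw [h.2]
  · exact (key s r y x hs hrs h.1.symm h.2.symm).elim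

lemma rayParam_image {α β y₀ : ℝ} (hα : 0 < α) (hβ : 0 < β)
    (h₀ : α * softplus y₀ + β * y₀ = 0) :
    rayParam '' (Set.Ioo 0 1 ×ˢ Set.Ioi y₀) = amoebaSector α β := by
  ext ⟨X, Y⟩
  constructor
  · rintro ⟨⟨r, y⟩, ⟨⟨hr0, hr1⟩, hy⟩, h⟩
    simp only [rayParam, Prod.mk.injEq, Set.mem_Ioi] at h hr0 hr1 hy
    obtain ⟨rfl, rfl⟩ := h
    refine ⟨mul_lt_mul_of_pos_left (lt_softplus y) hr0, exp_mul_softplus_lt hr1 y, ?_⟩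
    have h1 := mul_lt_mul_of_pos_left (softplus_lt_softplus hy) hα
    have h2 := mul_lt_mul_of_pos_left hy hβ
    have : 0 < r * (α * softplus y + β * y) := mul_pos hr0 (by linarith)
    simp only
    linarith
  · rintro ⟨h1, h2, h3⟩
    simp only at h1 h2 h3
    have hX : 0 < X := by nlinarith
    have hcont : Continuous fun t : ℝ => Real.exp (t * X) - Real.exp (t * Y) := by fun_prop
    -- Since `Y < X` and `0 < X`, the term `e^{TX}` dominates, so the ray through `(X, Y)`
    -- eventually leaves the region. The intermediate value theorem then gives the crossing point.
    obtain ⟨T, hT1, hT⟩ : ∃ T : ℝ, 1 ≤ T ∧ 1 < Real.exp (T * X) - Real.exp (T * Y) := by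
      have hT : ∀ T : ℝ, Real.exp (T * X) - Real.exp (T * Y) =
          Real.exp (T * X) * (1 - Real.exp (T * (Y - X))) := by
        intro T
        rw [mul_sub, ← Real.exp_add]
        ring_nf
      have t1 : Tendsto (fun T : ℝ => Real.exp (T * X)) atTop atTop :=
        Real.tendsto_exp_atTop.comp (tendsto_id.atTop_mul_const hX)
      have t2 : Tendsto (fun T : ℝ => 1 - Real.exp (T * (Y - X))) atTop (𝓝 (1 - 0)) :=
        tendsto_const_nhds.sub (Real.tendsto_exp_atBot.comp
          (tendsto_id.atTop_mul_const_of_neg (by linarith)))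
      have t3 := t1.atTop_mul_pos (by norm_num) t2
      obtain ⟨T, hT'⟩ := ((eventually_ge_atTop 1).and (t3.eventually_gt_atTop 1)).exists
      exact ⟨T, hT'.1, by rw [hT]; exact hT'.2⟩
    obtain ⟨t, ⟨ht1, -⟩, ht⟩ := intermediate_value_Icc hT1 hcont.continuousOn
      (show (1 : ℝ) ∈ Set.Icc _ _ from ⟨by simp only [one_mul]; linarith, hT.le⟩)
    simp only at ht
    have ht1' : 1 < t := by
      refine ht1.lt_of_ne ?_
      rintro rfl
      simp only [one_mul] at ht
      linarith
    have ht0 : 0 < t := by linarith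
    have hs : softplus (t * Y) = t * X := by
      rw [softplus, ← ht]
      simp
    refine ⟨(t⁻¹, t * Y), ⟨⟨by simpa using ht0, inv_lt_one_of_one_lt₀ ht1'⟩, ?_⟩, ?_⟩
    -- If `t * Y ≤ y₀`, monotonicity of `softplus` would make `α X + β Y` nonpositive after scaling
    -- by `t`.
    · by_contra hcon
      simp only [Set.mem_Ioi, not_lt] at hcon
      have hle : softplus (t * Y) ≤ softplus y₀ := by
        rcases hcon.eq_or_lt with h | h
        · rw [h]
        · exact (softplus_lt_softplus h).le
      rw [hs] at hle
      have := mul_pos ht0 h3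
      nlinarith [mul_le_mul_of_nonneg_left hle hα.le, mul_le_mul_of_nonneg_left hcon hβ.le]
    · simp only [rayParam, hs]
      ext <;> field_simp

/-- The derivative of `rayParam`. -/
noncomputable def fderivRayParam (p : ℝ × ℝ) : ℝ × ℝ →L[ℝ] ℝ × ℝ :=
  (Matrix.toLin (.finTwoProd ℝ) (.finTwoProd ℝ)
    !![softplus p.2, p.1 * (Real.exp p.2 / (1 + Real.exp p.2)); p.2, p.1]).toContinuousLinearMap

lemma hasFDerivAt_rayParam (p : ℝ × ℝ) : HasFDerivAt rayParam (fderivRayParam p) p := by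
  unfold fderivRayParam
  rw [Matrix.toLin_finTwoProd_toContinuousLinearMap]
  have h1 := (hasFDerivAt_fst (p := p) (𝕜 := ℝ)).fun_mul
    ((hasDerivAt_softplus p.2).comp_hasFDerivAt p hasFDerivAt_snd)
  have h2 := (hasFDerivAt_fst (p := p) (𝕜 := ℝ)).fun_mul (hasFDerivAt_snd (p := p) (𝕜 := ℝ))
  refine (h1.prodMk h2).congr_fderiv ?_
  congr 1 <;> simp [smul_smul, add_comm]

lemma det_fderivRayParam (p : ℝ × ℝ) : (fderivRayParam p).det =
    p.1 * (softplus p.2 - p.2 * (Real.exp p.2 / (1 + Real.exp p.2))) := by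
  unfold fderivRayParam
  simp only [LinearMap.det_toContinuousLinearMap, LinearMap.det_toLin, Matrix.det_fin_two_of]
  ring

/-- At `x = -e^y` and at `x = 1 + e^y` the numbers `log |x|` and `log |1 - x|` are `y` and `softplus
y` in the two orders, so both derivatives contain `softplus y - y * softplus' y` as a factor. -/
lemma hasDerivAt_sectorPrimitive (α β y : ℝ) :
    HasDerivAt (fun y => 3 * (β * realL3 (-Real.exp y) - α * realL3 (1 + Real.exp y)))
      ((α * softplus y + β * y) * (softplus y - y * (Real.exp y / (1 + Real.exp y)))) y := by
  have hE := Real.exp_pos y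
  have he := Real.hasDerivAt_exp y
  have h1 := (hasDerivAt_realL3 (x := -Real.exp y) (by linarith) (by linarith)).comp y he.fun_neg
  have h2 := (hasDerivAt_realL3 (x := 1 + Real.exp y) (by linarith) (by linarith)).comp y
    (he.const_add 1)
  refine (((h1.const_mul β).fun_sub (h2.const_mul α)).const_mul 3).congr_deriv ?_
  have e1 : 1 - (1 + Real.exp y) = -Real.exp y := by ring
  have e2 : 1 - -Real.exp y = 1 + Real.exp y := by ring
  rw [e1, e2, Real.log_neg_eq_log, Real.log_exp, ← softplus]
  field_simp
  ring

/-- Both arguments go to infinity, and inversion carries them to `0`, where `𝓛_3` tends to `0`. -/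
lemma tendsto_sectorPrimitive (α β : ℝ) :
    Tendsto (fun y => 3 * (β * realL3 (-Real.exp y) - α * realL3 (1 + Real.exp y)))
      atTop (𝓝 0) := by
  have h1 : Tendsto (fun y => realL3 (-Real.exp y)) atTop (𝓝 0) := by
    have : Tendsto (fun y : ℝ => (-Real.exp y)⁻¹) atTop (𝓝[≠] 0) := by
      refine tendsto_nhdsWithin_iff.2 ⟨?_, .of_forall fun y => ?_⟩
      · exact tendsto_inv_atBot_zero.comp (tendsto_neg_atTop_atBot.comp Real.tendsto_exp_atTop)
      · simp
    refine (tendsto_realL3_zero.comp this).congr fun y => ?_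
    exact realL3_inv_of_neg (by linarith [Real.exp_pos y])
  have h2 : Tendsto (fun y => realL3 (1 + Real.exp y)) atTop (𝓝 0) := by
    have : Tendsto (fun y : ℝ => (1 + Real.exp y)⁻¹) atTop (𝓝[≠] 0) := by
      refine tendsto_nhdsWithin_iff.2 ⟨?_, .of_forall fun y => ?_⟩
      · exact tendsto_inv_atTop_zero.comp
          (tendsto_atTop_add_const_left _ _ Real.tendsto_exp_atTop)
      · simp only [Set.mem_compl_iff, Set.mem_singleton_iff, inv_eq_zero]
        positivity
    refine (tendsto_realL3_zero.comp this).congr fun y => ?_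
    exact realL3_inv_of_one_lt (by linarith [Real.exp_pos y])
  have := ((h1.const_mul β).sub (h2.const_mul α)).const_mul 3
  simpa using this

lemma lintegral_Ioo_sq : ∫⁻ r in Set.Ioo (0 : ℝ) 1, ENNReal.ofReal (r ^ 2) =
    ENNReal.ofReal (1 / 3) := by
  rw [← ofReal_integral_eq_lintegral_ofReal, ← integral_Ioc_eq_integral_Ioo,
    ← intervalIntegral.integral_of_le zero_le_one, integral_pow]
  · norm_num
  · exact ((continuous_pow 2).integrableOn_Icc).mono_set Set.Ioo_subset_Icc_self
  · exact .of_forall fun r => sq_nonneg r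

/-- The nonnegativity is recorded because `ENNReal.ofReal` would otherwise lose the value. With a
Lebesgue integral in `ENNReal`, finiteness and value come together. -/
lemma lintegral_amoebaSector {α β y₀ : ℝ} (hα : 0 < α) (hβ : 0 < β)
    (h₀ : α * softplus y₀ + β * y₀ = 0) :
    0 ≤ α * realL3 (1 + Real.exp y₀) - β * realL3 (-Real.exp y₀) ∧
    ∫⁻ p in amoebaSector α β, ENNReal.ofReal (α * p.1 + β * p.2) =
      ENNReal.ofReal (α * realL3 (1 + Real.exp y₀) - β * realL3 (-Real.exp y₀)) := by
  set h : ℝ → ℝ := fun y =>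
    (α * softplus y + β * y) * (softplus y - y * (Real.exp y / (1 + Real.exp y))) with hh
  have hmeas : Measurable h := by
    have := measurable_softplus
    fun_prop
  have hpos : ∀ y ∈ Set.Ioi y₀, 0 ≤ h y := by
    intro y hy
    refine mul_nonneg ?_ (softplus_sub_mul_deriv_pos y).le
    have h1 := mul_lt_mul_of_pos_left (softplus_lt_softplus hy) hα
    have h2 := mul_lt_mul_of_pos_left (Set.mem_Ioi.1 hy) hβ
    linarith
  have hder := hasDerivAt_sectorPrimitive α β
  have hint := integrableOn_Ioi_deriv_of_nonneg (hder y₀).continuousAt.continuousWithinAt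
    (fun y _ => hder y) hpos (tendsto_sectorPrimitive α β)
  have hval := integral_Ioi_of_hasDerivAt_of_nonneg (hder y₀).continuousAt.continuousWithinAt
    (fun y _ => hder y) hpos (tendsto_sectorPrimitive α β)
  have hnn : 0 ≤ ∫ y in Set.Ioi y₀, h y := setIntegral_nonneg measurableSet_Ioi hpos
  refine ⟨by rw [hval] at hnn; linarith, ?_⟩
  rw [← rayParam_image hα hβ h₀, lintegral_image_eq_lintegral_abs_det_fderiv_mul volume
    (measurableSet_Ioo.prod measurableSet_Ioi)
    (fun p _ => (hasFDerivAt_rayParam p).hasFDerivWithinAt)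
    (injOn_rayParam.mono (Set.prod_mono (fun r hr => hr.1) (Set.subset_univ _)))]
  have hprod : ∀ p ∈ Set.Ioo (0 : ℝ) 1 ×ˢ Set.Ioi y₀,
      ENNReal.ofReal |(fderivRayParam p).det| *
        ENNReal.ofReal (α * (rayParam p).1 + β * (rayParam p).2) =
      ENNReal.ofReal (p.1 ^ 2) * ENNReal.ofReal (h p.2) := by
    rintro ⟨r, y⟩ ⟨⟨hr, -⟩, -⟩
    simp only at hr
    have hd : 0 < r * (softplus y - y * (Real.exp y / (1 + Real.exp y))) :=
      mul_pos hr (softplus_sub_mul_deriv_pos y)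
    rw [det_fderivRayParam, abs_of_pos hd, ← ENNReal.ofReal_mul hd.le,
      ← ENNReal.ofReal_mul (sq_nonneg r)]
    congr 1
    simp only [rayParam, hh]
    ring
  rw [setLIntegral_congr_fun (measurableSet_Ioo.prod measurableSet_Ioi) hprod,
    Measure.volume_eq_prod, ← Measure.prod_restrict,
    lintegral_prod_mul (f := fun r : ℝ => ENNReal.ofReal (r ^ 2))
      (g := fun y => ENNReal.ofReal (h y)) (by fun_prop) hmeas.ennreal_ofReal.aemeasurable, lintegral_Ioo_sq,
    ← ofReal_integral_eq_lintegral_ofReal hint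
      ((ae_restrict_iff' measurableSet_Ioi).2 (.of_forall hpos)), hval,
    ← ENNReal.ofReal_mul (by norm_num)]
  congr 1
  ring

/-! ### The amoeba of a line and its two sectors. -/

/-- The amoeba of a line: the points `(X, Y)` such that `1`, `e ^ X`, `e ^ Y` are the sides of a
nondegenerate triangle. -/
def lineAmoeba : Set (ℝ × ℝ) :=
  {p | Real.exp p.1 < 1 + Real.exp p.2 ∧ Real.exp p.2 < 1 + Real.exp p.1 ∧
    1 < Real.exp p.1 + Real.exp p.2}

lemma measurableSet_and_lt {f₁ g₁ f₂ g₂ f₃ g₃ : ℝ × ℝ → ℝ} (hf₁ : Measurable f₁)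
    (hg₁ : Measurable g₁) (hf₂ : Measurable f₂) (hg₂ : Measurable g₂) (hf₃ : Measurable f₃)
    (hg₃ : Measurable g₃) : MeasurableSet {p | f₁ p < g₁ p ∧ f₂ p < g₂ p ∧ f₃ p < g₃ p} :=
  (measurableSet_lt hf₁ hg₁).inter ((measurableSet_lt hf₂ hg₂).inter (measurableSet_lt hf₃ hg₃))

lemma measurableSet_lineAmoeba : MeasurableSet lineAmoeba := by
  apply measurableSet_and_lt <;> fun_prop

lemma measurableSet_amoebaSector (α β : ℝ) : MeasurableSet (amoebaSector α β) := by
  apply measurableSet_and_lt <;> fun_prop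

lemma volume_diagonal_prod : volume {p : ℝ × ℝ | p.1 = p.2} = 0 := by
  rw [Measure.volume_eq_prod, Measure.measure_prod_null (measurableSet_eq_fun (by fun_prop)
    (by fun_prop))]
  refine .of_forall fun x => ?_
  have : Prod.mk x ⁻¹' {p : ℝ × ℝ | p.1 = p.2} = {x} := by
    ext y
    simp [eq_comm]
  change volume (Prod.mk x ⁻¹' {p : ℝ × ℝ | p.1 = p.2}) = 0
  rw [this]
  simp

/-- `ENNReal.ofReal` keeps only the positive part of the linear form. Where it is positive, the
larger of `X`, `Y` is positive, so off the null diagonal only one of the three triangle inequalities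
is not automatic. -/
lemma lintegral_lineAmoeba {α β : ℝ} (hα : 0 < α) (hβ : 0 < β) :
    ∫⁻ p in lineAmoeba, ENNReal.ofReal (α * p.1 + β * p.2) =
      (∫⁻ p in amoebaSector α β, ENNReal.ofReal (α * p.1 + β * p.2)) +
        ∫⁻ p in amoebaSector β α, ENNReal.ofReal (β * p.1 + α * p.2) := by
  have hswap : ∫⁻ p in amoebaSector β α, ENNReal.ofReal (β * p.1 + α * p.2) =
      ∫⁻ p in Prod.swap ⁻¹' amoebaSector β α, ENNReal.ofReal (α * p.1 + β * p.2) := by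
    have hmp : MeasurePreserving (Prod.swap : ℝ × ℝ → ℝ × ℝ) volume volume :=
      Measure.measurePreserving_swap
    rw [← hmp.setLIntegral_comp_preimage (measurableSet_amoebaSector β α) (by fun_prop)]
    simp only [Prod.fst_swap, Prod.snd_swap, add_comm]
  have hmS := measurableSet_amoebaSector α β
  have hmS' : MeasurableSet (Prod.swap ⁻¹' amoebaSector β α) :=
    measurable_swap (measurableSet_amoebaSector β α)
  rw [hswap, ← lintegral_indicator measurableSet_lineAmoeba, ← lintegral_indicator hmS,
    ← lintegral_indicator hmS', ← lintegral_add_left (Measurable.indicator (by fun_prop) hmS)]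
  refine lintegral_congr_ae ?_
  have hdiag : ∀ᵐ p : ℝ × ℝ, p.1 ≠ p.2 := by
    rw [ae_iff]
    simpa using volume_diagonal_prod
  filter_upwards [hdiag] with p hp
  obtain ⟨X, Y⟩ := p
  simp only at hp
  classical
  rcases le_or_gt (α * X + β * Y) 0 with hle | hgt
  · simp only [Set.indicator_apply, ENNReal.ofReal_of_nonpos hle, ite_self, add_zero]
  · rcases lt_or_gt_of_ne hp with h | h
    · have hY : 0 < Y := by nlinarith
      have h1 := Real.exp_pos X
      have h2 := Real.one_lt_exp_iff.2 hY
      have h3 := Real.exp_lt_exp.2 h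
      have e1 : (X, Y) ∉ amoebaSector α β := fun hh => lt_asymm h hh.1
      have e2 : (X, Y) ∈ lineAmoeba ↔ (X, Y) ∈ Prod.swap ⁻¹' amoebaSector β α := by
        simp only [lineAmoeba, amoebaSector, Set.mem_ofPred_eq, Set.mem_preimage, Prod.swap_prod_mk]
        constructor
        · rintro ⟨-, h', -⟩
          exact ⟨h, h', by linarith⟩
        · rintro ⟨-, h', -⟩
          exact ⟨by linarith, h', by linarith⟩
      simp only [Set.indicator_apply, e1, e2, if_false, zero_add]
    · have hX : 0 < X := by nlinarith
      have h1 := Real.exp_pos Y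
      have h2 := Real.one_lt_exp_iff.2 hX
      have h3 := Real.exp_lt_exp.2 h
      have e1 : (X, Y) ∉ Prod.swap ⁻¹' amoebaSector β α := fun hh => lt_asymm h hh.1
      have e2 : (X, Y) ∈ lineAmoeba ↔ (X, Y) ∈ amoebaSector α β := by
        simp only [lineAmoeba, amoebaSector, Set.mem_ofPred_eq]
        constructor
        · rintro ⟨h', -, -⟩
          exact ⟨h, h', by linarith⟩
        · rintro ⟨-, h', -⟩
          exact ⟨h', by linarith, by linarith⟩
      simp only [Set.indicator_apply, e1, e2, if_false, add_zero]

/-! ### From the angles of a triangle to the logarithms of its sides. -/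

/-- The open standard triangle, parametrizing Euclidean triangles by two of their angles, in units
of `π`. -/
def angleTriangle : Set (ℝ × ℝ) := {p | 0 < p.1 ∧ 0 < p.2 ∧ p.1 + p.2 < 1}

lemma measurableSet_angleTriangle : MeasurableSet angleTriangle := by
  apply measurableSet_and_lt <;> fun_prop

/-- The logarithms of the sides of a triangle with given angles, one side being normalized
to `1`. -/
noncomputable def logSides (p : ℝ × ℝ) : ℝ × ℝ :=
  (Real.log (Real.sin (Real.pi * p.2)) - Real.log (Real.sin (Real.pi * (p.1 + p.2))),
    Real.log (Real.sin (Real.pi * p.1)) - Real.log (Real.sin (Real.pi * (p.1 + p.2))))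

lemma sin_pi_mul_pos {u : ℝ} (h0 : 0 < u) (h1 : u < 1) : 0 < Real.sin (Real.pi * u) :=
  Real.sin_pos_of_pos_of_lt_pi (by positivity) (by nlinarith [Real.pi_pos])

lemma sin_pos_of_mem_angleTriangle {p : ℝ × ℝ} (hp : p ∈ angleTriangle) :
    0 < Real.sin (Real.pi * p.1) ∧ 0 < Real.sin (Real.pi * p.2) ∧
      0 < Real.sin (Real.pi * (p.1 + p.2)) := by
  obtain ⟨h1, h2, h3⟩ := hp
  exact ⟨sin_pi_mul_pos h1 (by linarith), sin_pi_mul_pos h2 (by linarith),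
    sin_pi_mul_pos (by linarith) h3⟩

lemma sin_sq_eq_law_of_cosines (a b : ℝ) :
    Real.sin a ^ 2 = Real.sin (a + b) ^ 2 - 2 * Real.sin (a + b) * Real.sin b * Real.cos a +
      Real.sin b ^ 2 := by
  rw [Real.sin_add]
  linear_combination (-Real.sin a ^ 2) * Real.sin_sq_add_cos_sq b +
    Real.sin b ^ 2 * Real.sin_sq_add_cos_sq a

lemma exp_logSides {p : ℝ × ℝ} (hp : p ∈ angleTriangle) :
    Real.exp (logSides p).1 = Real.sin (Real.pi * p.2) / Real.sin (Real.pi * (p.1 + p.2)) ∧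
    Real.exp (logSides p).2 = Real.sin (Real.pi * p.1) / Real.sin (Real.pi * (p.1 + p.2)) := by
  obtain ⟨h1, h2, h3⟩ := sin_pos_of_mem_angleTriangle hp
  simp only [logSides, Real.exp_sub, Real.exp_log h1, Real.exp_log h2, Real.exp_log h3, and_self]

lemma cos_eq_of_logSides {p : ℝ × ℝ} (hp : p ∈ angleTriangle) :
    Real.cos (Real.pi * p.1) = (1 + Real.exp (logSides p).1 ^ 2 - Real.exp (logSides p).2 ^ 2) /
      (2 * Real.exp (logSides p).1) ∧
    Real.cos (Real.pi * p.2) = (1 + Real.exp (logSides p).2 ^ 2 - Real.exp (logSides p).1 ^ 2) /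
      (2 * Real.exp (logSides p).2) := by
  obtain ⟨h1, h2, h3⟩ := sin_pos_of_mem_angleTriangle hp
  rw [(exp_logSides hp).1, (exp_logSides hp).2]
  have e1 := sin_sq_eq_law_of_cosines (Real.pi * p.1) (Real.pi * p.2)
  have e2 := sin_sq_eq_law_of_cosines (Real.pi * p.2) (Real.pi * p.1)
  rw [add_comm (Real.pi * p.2), ← mul_add] at e2
  rw [← mul_add] at e1
  constructor
  · field_simp
    linear_combination e1
  · field_simp
    linear_combination e2

lemma pi_mul_injective_cos {u v : ℝ} (hu0 : 0 < u) (hu1 : u < 1) (hv0 : 0 < v) (hv1 : v < 1)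
    (h : Real.cos (Real.pi * u) = Real.cos (Real.pi * v)) : u = v := by
  have hp := Real.pi_pos
  have := Real.injOn_cos (show Real.pi * u ∈ Set.Icc 0 Real.pi from ⟨by positivity, by nlinarith⟩)
    (show Real.pi * v ∈ Set.Icc 0 Real.pi from ⟨by positivity, by nlinarith⟩) h
  exact mul_left_cancel₀ hp.ne' this

/-- The law of cosines recovers the angles from the sides. -/
lemma injOn_logSides : Set.InjOn logSides angleTriangle := by
  intro p hp p' hp' h
  have e := cos_eq_of_logSides hp
  rw [h, ← (cos_eq_of_logSides hp').1, ← (cos_eq_of_logSides hp').2] at e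
  obtain ⟨h1, h2, h3⟩ := hp
  obtain ⟨h1', h2', h3'⟩ := hp'
  exact Prod.ext (pi_mul_injective_cos h1 (by linarith) h1' (by linarith) e.1)
    (pi_mul_injective_cos h2 (by linarith) h2' (by linarith) e.2)

lemma cos_lt_one_of_mem {a : ℝ} (h0 : 0 < a) (h1 : a < Real.pi) : Real.cos a < 1 ∧
    -1 < Real.cos a := by
  have h := Real.sin_pos_of_pos_of_lt_pi h0 h1
  have := Real.sin_sq_add_cos_sq a
  constructor <;> nlinarith

lemma logSides_image : logSides '' angleTriangle = lineAmoeba := by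
  have hpi := Real.pi_pos
  ext ⟨X, Y⟩
  constructor
  · rintro ⟨p, hp, h⟩
    obtain ⟨e1, e2⟩ := exp_logSides hp
    obtain ⟨h1, h2, h3⟩ := sin_pos_of_mem_angleTriangle hp
    rw [h] at e1 e2
    obtain ⟨q1, q2, q3⟩ := hp
    have ca := cos_lt_one_of_mem (a := Real.pi * p.1) (by positivity) (by nlinarith)
    have cb := cos_lt_one_of_mem (a := Real.pi * p.2) (by positivity) (by nlinarith)
    have cc := cos_lt_one_of_mem (a := Real.pi * (p.1 + p.2)) (by positivity) (by nlinarith)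
    have i1 : Real.sin (Real.pi * p.2) < Real.sin (Real.pi * (p.1 + p.2)) +
        Real.sin (Real.pi * p.1) := by
      have : Real.sin (Real.pi * p.2) =
          Real.sin (Real.pi * (p.1 + p.2) - Real.pi * p.1) := by ring_nf
      rw [this, Real.sin_sub]
      nlinarith
    have i2 : Real.sin (Real.pi * p.1) < Real.sin (Real.pi * (p.1 + p.2)) +
        Real.sin (Real.pi * p.2) := by
      have : Real.sin (Real.pi * p.1) =
          Real.sin (Real.pi * (p.1 + p.2) - Real.pi * p.2) := by ring_nf
      rw [this, Real.sin_sub]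
      nlinarith
    have i3 : Real.sin (Real.pi * (p.1 + p.2)) < Real.sin (Real.pi * p.2) +
        Real.sin (Real.pi * p.1) := by
      rw [mul_add, Real.sin_add]
      nlinarith
    simp only [lineAmoeba, Set.mem_ofPred_eq, e1, e2]
    refine ⟨?_, ?_, ?_⟩
    · rw [← sub_pos]; field_simp; linarith
    · rw [← sub_pos]; field_simp; linarith
    · rw [← sub_pos]; field_simp; linarith
  · rintro ⟨h1, h2, h3⟩
    simp only at h1 h2 h3
    set q := Real.exp X with hq
    set p := Real.exp Y with hp
    have hq0 : 0 < q := Real.exp_pos X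
    have hp0 : 0 < p := Real.exp_pos Y
    set a := Real.arccos ((1 + q ^ 2 - p ^ 2) / (2 * q)) with ha
    set b := Real.arccos ((1 + p ^ 2 - q ^ 2) / (2 * p)) with hb
    have a1 : (1 + q ^ 2 - p ^ 2) / (2 * q) < 1 := by
      rw [div_lt_one (by positivity)]; nlinarith
    have a2 : -1 < (1 + q ^ 2 - p ^ 2) / (2 * q) := by
      rw [lt_div_iff₀ (by positivity)]; nlinarith
    have b1 : (1 + p ^ 2 - q ^ 2) / (2 * p) < 1 := by
      rw [div_lt_one (by positivity)]; nlinarith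
    have b2 : -1 < (1 + p ^ 2 - q ^ 2) / (2 * p) := by
      rw [lt_div_iff₀ (by positivity)]; nlinarith
    have ca : Real.cos a = (1 + q ^ 2 - p ^ 2) / (2 * q) := Real.cos_arccos a2.le a1.le
    have cb : Real.cos b = (1 + p ^ 2 - q ^ 2) / (2 * p) := Real.cos_arccos b2.le b1.le
    have ha0 : 0 < a := Real.arccos_pos.2 a1
    have hb0 : 0 < b := Real.arccos_pos.2 b1
    have ha1 : a < Real.pi := by
      refine lt_of_le_of_ne (Real.arccos_le_pi _) fun h => ?_
      rw [h, Real.cos_pi] at ca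
      linarith
    have hb1 : b < Real.pi := by
      refine lt_of_le_of_ne (Real.arccos_le_pi _) fun h => ?_
      rw [h, Real.cos_pi] at cb
      linarith
    have sa := Real.sin_pos_of_pos_of_lt_pi ha0 ha1
    have sb := Real.sin_pos_of_pos_of_lt_pi hb0 hb1
    -- Law of sines: the squares of both sides agree, being the same polynomial in the sides over a
    -- common denominator.
    have hs : q * Real.sin a = p * Real.sin b := by
      have : (q * Real.sin a) ^ 2 = (p * Real.sin b) ^ 2 := by
        rw [mul_pow, mul_pow, Real.sin_sq, Real.sin_sq, ca, cb]
        field_simp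
        ring
      exact (pow_left_inj₀ (by positivity) (by positivity) two_ne_zero).1 this
    have hc : p * Real.sin (a + b) = Real.sin a := by
      rw [Real.sin_add]
      -- The two other sides project onto the side of length `1`.
      have : p * Real.cos b + q * Real.cos a = 1 := by
        rw [ca, cb]
        field_simp
        ring
      linear_combination (Real.sin a) * this - Real.cos a * hs
    have hc' : q * Real.sin (a + b) = Real.sin b := by
      have : p * (q * Real.sin (a + b)) = p * Real.sin b := by
        rw [← hs, ← hc]; ring
      exact mul_left_cancel₀ hp0.ne' this
    have sc : 0 < Real.sin (a + b) := by
      by_contra hcon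
      nlinarith
    have hab : a + b < Real.pi := by
      by_contra hcon
      have := Real.sin_nonpos_of_nonpos_of_neg_pi_le (x := a + b - 2 * Real.pi) (by linarith)
        (by linarith)
      rw [Real.sin_sub_two_pi] at this
      linarith
    have e1 : Real.pi * (a / Real.pi) = a := by field_simp
    have e2 : Real.pi * (b / Real.pi) = b := by field_simp
    refine ⟨(a / Real.pi, b / Real.pi), ⟨by positivity, by positivity, ?_⟩, ?_⟩
    · simp only
      rw [← add_div, div_lt_one hpi]
      exact hab
    · simp only [logSides, mul_add, e1, e2]
      rw [← hc, ← hc', Real.log_mul hp0.ne' sc.ne', Real.log_mul hq0.ne' sc.ne', hp, hq,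
        Real.log_exp, Real.log_exp]
      simp

/-- The derivative of `logSides`. -/
noncomputable def fderivLogSides (p : ℝ × ℝ) : ℝ × ℝ →L[ℝ] ℝ × ℝ :=
  (Matrix.toLin (.finTwoProd ℝ) (.finTwoProd ℝ)
    !![-(Real.pi * Real.cos (Real.pi * (p.1 + p.2)) / Real.sin (Real.pi * (p.1 + p.2))),
      Real.pi * Real.cos (Real.pi * p.2) / Real.sin (Real.pi * p.2) -
        Real.pi * Real.cos (Real.pi * (p.1 + p.2)) / Real.sin (Real.pi * (p.1 + p.2));
      Real.pi * Real.cos (Real.pi * p.1) / Real.sin (Real.pi * p.1) -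
        Real.pi * Real.cos (Real.pi * (p.1 + p.2)) / Real.sin (Real.pi * (p.1 + p.2)),
      -(Real.pi * Real.cos (Real.pi * (p.1 + p.2)) /
        Real.sin (Real.pi * (p.1 + p.2)))]).toContinuousLinearMap

lemma hasDerivAt_log_sin_pi_mul {u : ℝ} (hu : Real.sin (Real.pi * u) ≠ 0) :
    HasDerivAt (fun u => Real.log (Real.sin (Real.pi * u)))
      (Real.pi * Real.cos (Real.pi * u) / Real.sin (Real.pi * u)) u := by
  have h : HasDerivAt (fun u : ℝ => Real.pi * u) Real.pi u := by
    simpa using (hasDerivAt_id u).const_mul Real.pi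
  refine (h.sin.log hu).congr_deriv ?_
  ring

lemma hasFDerivAt_logSides {p : ℝ × ℝ} (hp : p ∈ angleTriangle) :
    HasFDerivAt logSides (fderivLogSides p) p := by
  obtain ⟨h1, h2, h3⟩ := sin_pos_of_mem_angleTriangle hp
  unfold fderivLogSides
  rw [Matrix.toLin_finTwoProd_toContinuousLinearMap]
  have d1 := (hasDerivAt_log_sin_pi_mul h1.ne').comp_hasFDerivAt p (hasFDerivAt_fst (𝕜 := ℝ))
  have d2 := (hasDerivAt_log_sin_pi_mul h2.ne').comp_hasFDerivAt p (hasFDerivAt_snd (𝕜 := ℝ))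
  have d3 := (hasDerivAt_log_sin_pi_mul h3.ne').comp_hasFDerivAt p
    ((hasFDerivAt_fst (𝕜 := ℝ) (p := p)).fun_add (hasFDerivAt_snd (𝕜 := ℝ) (p := p)))
  refine ((d2.fun_sub d3).prodMk (d1.fun_sub d3)).congr_fderiv ?_
  congr 1
  · module
  · module

/-- The entries are combinations of cotangents, and the addition formula `cot (a + b) (cot a + cot
b) = cot a cot b - 1` makes the determinant constant. -/
lemma abs_det_fderivLogSides {p : ℝ × ℝ} (hp : p ∈ angleTriangle) :
    |(fderivLogSides p).det| = Real.pi ^ 2 := by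
  obtain ⟨h1, h2, h3⟩ := sin_pos_of_mem_angleTriangle hp
  have : (fderivLogSides p).det = -Real.pi ^ 2 := by
    unfold fderivLogSides
    simp only [LinearMap.det_toContinuousLinearMap, LinearMap.det_toLin, Matrix.det_fin_two_of]
    have e := Real.cos_add (Real.pi * p.1) (Real.pi * p.2)
    have s := Real.sin_add (Real.pi * p.1) (Real.pi * p.2)
    rw [← mul_add] at e s
    field_simp
    linear_combination (Real.sin (Real.pi * (p.1 + p.2)) ^ 2) * e -
      Real.sin (Real.pi * (p.1 + p.2)) * Real.cos (Real.pi * (p.1 + p.2)) * s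
  rw [this, abs_neg, abs_of_nonneg (sq_nonneg _)]

lemma lintegral_angleTriangle (g : ℝ × ℝ → ENNReal) (hg : Measurable g) :
    ENNReal.ofReal (Real.pi ^ 2) * ∫⁻ p in angleTriangle, g (logSides p) =
      ∫⁻ p in lineAmoeba, g p := by
  have hm : Measurable logSides := by
    unfold logSides
    fun_prop
  rw [← logSides_image, lintegral_image_eq_lintegral_abs_det_fderiv_mul volume
    measurableSet_angleTriangle (fun p hp => (hasFDerivAt_logSides hp).hasFDerivWithinAt)
    injOn_logSides, ← lintegral_const_mul (f := fun p => g (logSides p)) _ (hg.comp hm)]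
  refine setLIntegral_congr_fun measurableSet_angleTriangle fun p hp => ?_
  simp only [abs_det_fderivLogSides hp]

/-! ### The modulus of the quotient on the torus. -/

/-- The rational function `(1 - x) ^ m (1 - y) ^ n / (1 - x y) ^ (m + n)` on the torus. -/
noncomputable def torusQuotient (m n : ℕ) (p : ℝ × ℝ) : ℂ :=
  (1 - Complex.exp (2 * Real.pi * Complex.I * (p.1 : ℂ))) ^ m *
    (1 - Complex.exp (2 * Real.pi * Complex.I * (p.2 : ℂ))) ^ n /
    (1 - Complex.exp (2 * Real.pi * Complex.I * (p.1 : ℂ)) *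
      Complex.exp (2 * Real.pi * Complex.I * (p.2 : ℂ))) ^ (m + n)

lemma measurable_torusQuotient (m n : ℕ) : Measurable (torusQuotient m n) := by
  unfold torusQuotient
  fun_prop

lemma norm_one_sub_exp_two_pi (u : ℝ) :
    ‖1 - Complex.exp (2 * Real.pi * Complex.I * (u : ℂ))‖ = 2 * |Real.sin (Real.pi * u)| := by
  have h := Complex.norm_exp_I_mul_ofReal_sub_one (2 * Real.pi * u)
  have e : 2 * Real.pi * Complex.I * (u : ℂ) = Complex.I * ((2 * Real.pi * u : ℝ) : ℂ) := by
    push_cast; ring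
  rw [norm_sub_rev, e, h, norm_mul, Real.norm_eq_abs, Real.norm_eq_abs, abs_two]
  ring_nf

lemma norm_torusQuotient (m n : ℕ) (p : ℝ × ℝ) :
    ‖torusQuotient m n p‖ = |Real.sin (Real.pi * p.1)| ^ m * |Real.sin (Real.pi * p.2)| ^ n /
      |Real.sin (Real.pi * (p.1 + p.2))| ^ (m + n) := by
  have e : Complex.exp (2 * Real.pi * Complex.I * (p.1 : ℂ)) *
      Complex.exp (2 * Real.pi * Complex.I * (p.2 : ℂ)) =
      Complex.exp (2 * Real.pi * Complex.I * ((p.1 + p.2 : ℝ) : ℂ)) := by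
    rw [← Complex.exp_add]
    push_cast
    ring_nf
  rw [torusQuotient, e, norm_div, norm_mul, norm_pow, norm_pow, norm_pow,
    norm_one_sub_exp_two_pi, norm_one_sub_exp_two_pi, norm_one_sub_exp_two_pi, mul_pow, mul_pow,
    mul_pow, pow_add 2 m n, mul_mul_mul_comm]
  exact mul_div_mul_left _ _ (by positivity)

lemma ofReal_posLog (x : ℝ) : ENNReal.ofReal (Real.posLog x) = ENNReal.ofReal (Real.log x) := by
  rw [Real.posLog, ENNReal.ofReal_max, ENNReal.ofReal_zero, max_eq_right zero_le]

lemma log_norm_torusQuotient (m n : ℕ) {p : ℝ × ℝ} (hp : p ∈ angleTriangle) :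
    Real.log ‖torusQuotient m n p‖ = n * (logSides p).1 + m * (logSides p).2 := by
  obtain ⟨h1, h2, h3⟩ := sin_pos_of_mem_angleTriangle hp
  rw [norm_torusQuotient, abs_of_pos h1, abs_of_pos h2, abs_of_pos h3,
    Real.log_div (by positivity) (by positivity), Real.log_mul (by positivity) (by positivity),
    Real.log_pow, Real.log_pow, Real.log_pow, logSides]
  push_cast
  ring

lemma norm_torusQuotient_reflect (m n : ℕ) (p : ℝ × ℝ) :
    ‖torusQuotient m n (1 - p)‖ = ‖torusQuotient m n p‖ := by
  have h : ∀ u : ℝ, |Real.sin (Real.pi * (1 - u))| = |Real.sin (Real.pi * u)| := by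
    intro u
    rw [mul_sub, mul_one, Real.sin_pi_sub]
  have h' : |Real.sin (Real.pi * (1 - p.1 + (1 - p.2)))| = |Real.sin (Real.pi * (p.1 + p.2))| := by
    have : Real.pi * (1 - p.1 + (1 - p.2)) = 2 * Real.pi - Real.pi * (p.1 + p.2) := by ring
    rw [this, Real.sin_two_pi_sub, abs_neg]
  simp only [norm_torusQuotient, Prod.fst_sub, Prod.snd_sub, Prod.fst_one, Prod.snd_one, h, h']

/-- Since `g` vanishes on the edges and on the antidiagonal, the square splits pointwise into the
triangle and its reflection. -/
lemma lintegral_unitSquare {g : ℝ × ℝ → ENNReal} (hg : Measurable g)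
    (hrefl : ∀ p, g (1 - p) = g p)
    (hzero : ∀ p : ℝ × ℝ, g p ≠ 0 → p.1 ≠ 0 ∧ p.1 ≠ 1 ∧ p.2 ≠ 0 ∧ p.2 ≠ 1 ∧ p.1 + p.2 ≠ 1) :
    ∫⁻ p in Set.Icc 0 1, g p = 2 * ∫⁻ p in angleTriangle, g p := by
  have hmp : MeasurePreserving (fun p : ℝ × ℝ => 1 - p) volume volume :=
    Measure.measurePreserving_sub_left volume 1
  have hT := measurableSet_angleTriangle
  have hT' : MeasurableSet ((fun p : ℝ × ℝ => 1 - p) ⁻¹' angleTriangle) := hmp.measurable hT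
  have e : ∫⁻ p in angleTriangle, g p = ∫⁻ p in (fun p : ℝ × ℝ => 1 - p) ⁻¹' angleTriangle, g p := by
    rw [← hmp.setLIntegral_comp_preimage hT hg]
    simp only [hrefl]
  rw [two_mul]
  nth_rw 2 [e]
  rw [← lintegral_indicator measurableSet_Icc, ← lintegral_indicator hT, ← lintegral_indicator hT',
    ← lintegral_add_left (hg.indicator hT)]
  refine lintegral_congr fun p => ?_
  classical
  simp only [Set.indicator_apply]
  by_cases h0 : g p = 0
  · simp [h0]
  · obtain ⟨h1, h2, h3, h4, h5⟩ := hzero p h0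
    have hI : p ∈ Set.Icc (0 : ℝ × ℝ) 1 ↔ (0 ≤ p.1 ∧ 0 ≤ p.2) ∧ p.1 ≤ 1 ∧ p.2 ≤ 1 := Iff.rfl
    have hA : p ∈ angleTriangle ↔ 0 < p.1 ∧ 0 < p.2 ∧ p.1 + p.2 < 1 := Iff.rfl
    have hB : p ∈ (fun p : ℝ × ℝ => 1 - p) ⁻¹' angleTriangle ↔
        0 < 1 - p.1 ∧ 0 < 1 - p.2 ∧ 1 - p.1 + (1 - p.2) < 1 := Iff.rfl
    rcases lt_or_gt_of_ne h5 with h | h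
    · have hB' : p ∉ (fun p : ℝ × ℝ => 1 - p) ⁻¹' angleTriangle := by
        rw [hB]
        rintro ⟨-, -, hh⟩
        linarith
      have : p ∈ Set.Icc (0 : ℝ × ℝ) 1 ↔ p ∈ angleTriangle := by
        rw [hI, hA]
        constructor
        · rintro ⟨⟨a, b⟩, -, -⟩
          exact ⟨a.lt_of_ne' h1, b.lt_of_ne' h3, h⟩
        · rintro ⟨a, b, -⟩
          exact ⟨⟨a.le, b.le⟩, by linarith, by linarith⟩
      simp only [this, hB', if_false, add_zero]
    · have hA' : p ∉ angleTriangle := by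
        rw [hA]
        rintro ⟨-, -, hh⟩
        linarith
      have : p ∈ Set.Icc (0 : ℝ × ℝ) 1 ↔ p ∈ (fun p : ℝ × ℝ => 1 - p) ⁻¹' angleTriangle := by
        rw [hI, hB]
        constructor
        · rintro ⟨-, a, b⟩
          exact ⟨sub_pos.2 (a.lt_of_ne h2), sub_pos.2 (b.lt_of_ne h4), by linarith⟩
        · rintro ⟨a, b, -⟩
          exact ⟨⟨by linarith, by linarith⟩, by linarith, by linarith⟩
      simp only [this, hA', if_false, zero_add]

/-- On the edges the numerator vanishes; on the antidiagonal, a pole, division by zero makes the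
value `0`. -/
lemma ne_of_norm_torusQuotient_ne_zero {m n : ℕ} (hm : 1 ≤ m) (hn : 1 ≤ n) {p : ℝ × ℝ}
    (h : ‖torusQuotient m n p‖ ≠ 0) :
    p.1 ≠ 0 ∧ p.1 ≠ 1 ∧ p.2 ≠ 0 ∧ p.2 ≠ 1 ∧ p.1 + p.2 ≠ 1 := by
  rw [norm_torusQuotient] at h
  have hm0 : m ≠ 0 := by omega
  have hn0 : n ≠ 0 := by omega
  refine ⟨?_, ?_, ?_, ?_, ?_⟩ <;> intro hh <;> refine h ?_ <;> rw [hh] <;> simp [hm0, hn0]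

lemma lintegral_posLog_torusQuotient {m n : ℕ} (hm : 1 ≤ m) (hn : 1 ≤ n) :
    ∫⁻ p in Set.Icc 0 1, ENNReal.ofReal (Real.posLog ‖torusQuotient m n p‖) =
      ENNReal.ofReal (2 / Real.pi ^ 2) *
        ∫⁻ p in lineAmoeba, ENNReal.ofReal (n * p.1 + m * p.2) := by
  have hmeas := measurable_torusQuotient m n
  have hpi := Real.pi_pos
  simp only [ofReal_posLog]
  rw [lintegral_unitSquare (by fun_prop) (by simp only [norm_torusQuotient_reflect, implies_true]),
    ← lintegral_angleTriangle _ (by fun_prop), ← mul_assoc,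
    ← ENNReal.ofReal_mul (by positivity), div_mul_cancel₀ _ (by positivity), ENNReal.ofReal_ofNat]
  · congr 1
    refine setLIntegral_congr_fun measurableSet_angleTriangle fun p hp => ?_
    simp only [log_norm_torusQuotient m n hp]
  · intro p hp
    refine ne_of_norm_torusQuotient_ne_zero hm hn fun h => hp ?_
    rw [h]
    simp

/-! ### Jensen's formula in `z` and absolute convergence. -/

lemma circleMap_two_pi_mul (t : ℝ) :
    circleMap 0 1 (2 * Real.pi * t) = Complex.exp (2 * Real.pi * Complex.I * (t : ℂ)) := by
  rw [circleMap_zero]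
  push_cast
  rw [one_mul]
  ring_nf

lemma integrableOn_log_norm_exp_sub (w : ℂ) :
    IntegrableOn (fun t : ℝ => Real.log ‖Complex.exp (2 * Real.pi * Complex.I * (t : ℂ)) - w‖)
      (Set.Icc 0 1) := by
  have hpi := Real.pi_pos
  have h : IntervalIntegrable (fun θ : ℝ => Real.log ‖circleMap 0 1 θ - w‖) volume 0
      (2 * Real.pi) := circleIntegrable_log_norm_sub_const 1
  have h' := h.comp_mul_left (c := 2 * Real.pi)
  rw [zero_div, div_self (by positivity), intervalIntegrable_iff_integrableOn_Ioc_of_le zero_le_one,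
    ← integrableOn_Icc_iff_integrableOn_Ioc] at h'
  simpa only [circleMap_two_pi_mul] using h'

lemma integral_log_norm_exp_sub (w : ℂ) :
    ∫ t in Set.Icc (0 : ℝ) 1, Real.log ‖Complex.exp (2 * Real.pi * Complex.I * (t : ℂ)) - w‖ =
      Real.posLog ‖w‖ := by
  have hpi := Real.pi_pos
  rw [← circleAverage_log_norm_sub_const_eq_posLog, Real.circleAverage, integral_Icc_eq_integral_Ioc,
    ← intervalIntegral.integral_of_le zero_le_one]
  simp only [← circleMap_two_pi_mul]
  rw [intervalIntegral.integral_comp_mul_left (fun θ => Real.log ‖circleMap 0 1 θ - w‖)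
    (by positivity : 2 * Real.pi ≠ 0)]
  simp

lemma abs_log_eq (r : ℝ) : |Real.log r| = 2 * Real.posLog r - Real.log r := by
  rw [Real.posLog]
  rcases le_total 0 (Real.log r) with h | h
  · rw [abs_of_nonneg h, max_eq_right h]; ring
  · rw [abs_of_nonpos h, max_eq_left h]; ring

/-- Write `|log r| = 2 log⁺ r - log r`, bound `log⁺ |e - w|` by `log 2 + log⁺ |w|`, and subtract the
mean `log⁺ |w|` given by Jensen. The bound is integrable in `w`, as Fubini requires. -/
lemma integral_abs_log_norm_exp_sub_le (w : ℂ) :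
    ∫ t in Set.Icc (0 : ℝ) 1, ‖Real.log ‖Complex.exp (2 * Real.pi * Complex.I * (t : ℂ)) - w‖‖ ≤
      2 * Real.log 2 + Real.posLog ‖w‖ := by
  have hi := integrableOn_log_norm_exp_sub w
  have hle : ∀ t : ℝ, ‖Real.log ‖Complex.exp (2 * Real.pi * Complex.I * (t : ℂ)) - w‖‖ ≤
      2 * (Real.log 2 + Real.posLog ‖w‖) -
        Real.log ‖Complex.exp (2 * Real.pi * Complex.I * (t : ℂ)) - w‖ := by
    intro t
    rw [Real.norm_eq_abs, abs_log_eq]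
    have h := Real.posLog_norm_add_le (Complex.exp (2 * Real.pi * Complex.I * (t : ℂ))) (-w)
    have e : ‖Complex.exp (2 * Real.pi * Complex.I * (t : ℂ))‖ = 1 := by
      rw [← circleMap_two_pi_mul]
      simp
    rw [e, norm_neg, ← sub_eq_add_neg, Real.posLog_one] at h
    linarith
  refine (integral_mono hi.norm ((integrable_const _).sub hi) hle).trans_eq ?_
  have := integral_sub (μ := volume.restrict (Set.Icc (0 : ℝ) 1))
    (integrable_const (2 * (Real.log 2 + Real.posLog ‖w‖))) hi
  refine this.trans ?_
  rw [integral_log_norm_exp_sub]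
  simp
  ring

/-- Splitting off the last of three real coordinates. -/
def splitLast : (Fin 3 → ℝ) ≃ᵐ ℝ × (ℝ × ℝ) :=
  (MeasurableEquiv.piFinSuccAbove (fun _ : Fin 3 => ℝ) 2).trans
    ((MeasurableEquiv.refl ℝ).prodCongr MeasurableEquiv.finTwoArrow)

lemma splitLast_apply (θ : Fin 3 → ℝ) : splitLast θ = (θ 2, (θ 0, θ 1)) := rfl

lemma measurePreserving_splitLast : MeasurePreserving splitLast volume volume :=
  (volume_preserving_piFinSuccAbove (fun _ : Fin 3 => ℝ) 2).trans
    ((MeasurePreserving.id volume).prod (volume_preserving_finTwoArrow ℝ))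

lemma splitLast_preimage_Icc :
    splitLast ⁻¹' (Set.Icc (0 : ℝ) 1 ×ˢ Set.Icc (0 : ℝ × ℝ) 1) = Set.Icc (0 : Fin 3 → ℝ) 1 := by
  ext θ
  simp only [Set.mem_preimage, splitLast_apply, Set.mem_prod, Set.mem_Icc, Prod.le_def,
    Pi.le_def, Fin.forall_fin_succ, Fin.isValue]
  simp
  tauto

lemma logAbsOnTorus_resFun (m n : ℕ) :
    logAbsOnTorus (resFun m n) = (fun q : ℝ × (ℝ × ℝ) =>
      Real.log ‖Complex.exp (2 * Real.pi * Complex.I * (q.1 : ℂ)) - torusQuotient m n q.2‖) ∘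
        splitLast := rfl

lemma integrable_and_integral_log_norm_exp_sub {X : Type*} [MeasurableSpace X] {ν : Measure X}
    [IsFiniteMeasure ν] {w : X → ℂ} (hw : Measurable w)
    (hint : Integrable (fun x => Real.posLog ‖w x‖) ν) :
    Integrable (fun q : ℝ × X =>
      Real.log ‖Complex.exp (2 * Real.pi * Complex.I * (q.1 : ℂ)) - w q.2‖)
        ((volume.restrict (Set.Icc (0 : ℝ) 1)).prod ν) ∧
    ∫ q : ℝ × X, Real.log ‖Complex.exp (2 * Real.pi * Complex.I * (q.1 : ℂ)) - w q.2‖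
      ∂((volume.restrict (Set.Icc (0 : ℝ) 1)).prod ν) = ∫ x, Real.posLog ‖w x‖ ∂ν := by
  have hmeas : Measurable fun q : ℝ × X =>
      Real.log ‖Complex.exp (2 * Real.pi * Complex.I * (q.1 : ℂ)) - w q.2‖ := by
    fun_prop
  have h : Integrable (fun q : ℝ × X =>
      Real.log ‖Complex.exp (2 * Real.pi * Complex.I * (q.1 : ℂ)) - w q.2‖)
        ((volume.restrict (Set.Icc (0 : ℝ) 1)).prod ν) := by
    rw [integrable_prod_iff' hmeas.aestronglyMeasurable]
    refine ⟨.of_forall fun x => integrableOn_log_norm_exp_sub (w x), ?_⟩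
    refine ((integrable_const (2 * Real.log 2)).add hint).mono' ?_ (.of_forall fun x => ?_)
    · exact (hmeas.norm.stronglyMeasurable.integral_prod_left').aestronglyMeasurable
    · rw [Real.norm_of_nonneg (integral_nonneg fun _ => norm_nonneg _)]
      exact integral_abs_log_norm_exp_sub_le (w x)
  refine ⟨h, ?_⟩
  rw [integral_prod_symm _ h]
  exact integral_congr_ae (.of_forall fun x => integral_log_norm_exp_sub (w x))

lemma logAbsOnTorus_resFun_integral {m n : ℕ} {I : ℝ} (hI : 0 ≤ I)
    (h : ∫⁻ p in Set.Icc 0 1, ENNReal.ofReal (Real.posLog ‖torusQuotient m n p‖) =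
      ENNReal.ofReal I) :
    IntegrableOn (logAbsOnTorus (resFun m n)) (Set.Icc (0 : Fin 3 → ℝ) 1) ∧
      logMahler (resFun m n) = I := by
  have hmeas := measurable_torusQuotient m n
  have hnn : ∀ p, 0 ≤ Real.posLog ‖torusQuotient m n p‖ := fun p => Real.posLog_nonneg
  have hm : Measurable fun p => Real.posLog ‖torusQuotient m n p‖ := by
    unfold Real.posLog
    fun_prop
  have hint : IntegrableOn (fun p => Real.posLog ‖torusQuotient m n p‖) (Set.Icc 0 1) := by
    refine ⟨hm.aestronglyMeasurable, ?_⟩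
    rw [hasFiniteIntegral_iff_ofReal (.of_forall hnn), h]
    exact ENNReal.ofReal_lt_top
  have hval : ∫ p in Set.Icc 0 1, Real.posLog ‖torusQuotient m n p‖ = I := by
    rw [integral_eq_lintegral_of_nonneg_ae (.of_forall hnn) hm.aestronglyMeasurable, h,
      ENNReal.toReal_ofReal hI]
  have : IsFiniteMeasure (volume.restrict (Set.Icc (0 : ℝ × ℝ) 1)) :=
    ⟨by simpa using isCompact_Icc.measure_lt_top⟩
  obtain ⟨h1, h2⟩ := integrable_and_integral_log_norm_exp_sub hmeas hint
  rw [Measure.prod_restrict, ← Measure.volume_eq_prod] at h1 h2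
  rw [logMahler, logAbsOnTorus_resFun, ← splitLast_preimage_Icc]
  refine ⟨?_, ?_⟩
  · exact (measurePreserving_splitLast.integrableOn_comp_preimage
      splitLast.measurableEmbedding).2 h1
  · exact (measurePreserving_splitLast.setIntegral_preimage_emb splitLast.measurableEmbedding
      _ _).trans (h2.trans hval)

/-! ### The roots `φ₁`, `φ₂` and the final evaluation. -/

lemma existsUnique_root_of_strictMonoOn {f : ℝ → ℝ} {s : Set ℝ} (hf : Continuous f)
    (hs : StrictMonoOn f s) {a b : ℝ} (hab : a ≤ b) (hsub : Set.Icc a b ⊆ s) (ha : f a ≤ 0)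
    (hb : 0 ≤ f b) : ∃! x, x ∈ s ∧ f x = 0 := by
  obtain ⟨x, hx, h0⟩ := intermediate_value_Icc hab hf.continuousOn (Set.mem_Icc.2 ⟨ha, hb⟩)
  exact ⟨x, ⟨hsub hx, h0⟩, fun y hy => hs.injOn hy.1 (hsub hx) (hy.2.trans h0.symm)⟩

lemma existsUnique_root_add {m n : ℕ} (hn : 1 ≤ n) :
    ∃! x : ℝ, x ∈ Set.Icc (0 : ℝ) 1 ∧ x ^ (m + n) + x ^ n - 1 = 0 := by
  refine existsUnique_root_of_strictMonoOn (f := fun x => x ^ (m + n) + x ^ n - 1) (by fun_prop) ?_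
    zero_le_one subset_rfl ?_ ?_
  · intro x hx y hy hxy
    have h1 := pow_lt_pow_left₀ hxy hx.1 (show m + n ≠ 0 by omega)
    have h2 := pow_lt_pow_left₀ hxy hx.1 (show n ≠ 0 by omega)
    simp only
    linarith
  · simp [show n ≠ 0 by omega]
  · simp

lemma existsUnique_root_sub {m n : ℕ} (hm : 1 ≤ m) (hn : 1 ≤ n) :
    ∃! x : ℝ, x ∈ Set.Ici (1 : ℝ) ∧ x ^ (m + n) - x ^ n - 1 = 0 := by
  refine existsUnique_root_of_strictMonoOn (f := fun x => x ^ (m + n) - x ^ n - 1) (by fun_prop) ?_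
    one_le_two Set.Icc_subset_Ici_self ?_ ?_
  · intro x hx y hy hxy
    have hx : (1 : ℝ) ≤ x := hx
    have h1 := pow_lt_pow_left₀ hxy (by linarith) (show m ≠ 0 by omega)
    have h2 := pow_lt_pow_left₀ hxy (by linarith) (show n ≠ 0 by omega)
    have h3 : 1 ≤ x ^ m := one_le_pow₀ hx
    have h4 : 1 ≤ x ^ n := one_le_pow₀ hx
    simp only [pow_add]
    nlinarith
  · simp
  · have h3 : (2 : ℝ) ≤ 2 ^ m := le_self_pow₀ one_le_two (by omega)
    have h4 : (1 : ℝ) ≤ 2 ^ n := one_le_pow₀ one_le_two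
    simp only [pow_add]
    nlinarith

lemma lintegral_amoebaSector_root_sub {m n : ℕ} (hm : 1 ≤ m) (hn : 1 ≤ n) {φ : ℝ} (h1 : 1 ≤ φ)
    (h : φ ^ (m + n) - φ ^ n - 1 = 0) :
    0 ≤ n * realL3 (φ ^ m) - m * realL3 (-φ ^ n) ∧
    ∫⁻ p in amoebaSector n m, ENNReal.ofReal (n * p.1 + m * p.2) =
      ENNReal.ofReal (n * realL3 (φ ^ m) - m * realL3 (-φ ^ n)) := by
  have h0 : 0 < φ := by linarith
  have hn0 : 0 < φ ^ n := by positivity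
  have hexp : Real.exp (-(n * Real.log φ)) = (φ ^ n)⁻¹ := by
    rw [Real.exp_neg, ← Real.log_pow, Real.exp_log hn0]
  have hsum : 1 + (φ ^ n)⁻¹ = φ ^ m := by
    rw [pow_add] at h
    field_simp
    linarith
  have hsp : softplus (-(n * Real.log φ)) = m * Real.log φ := by
    rw [softplus, hexp, hsum, Real.log_pow]
  -- The corner of the sector is `e^Y = φ^(-n)`, `e^X = φ^m`: the equation of `φ` says that it lies
  -- on the curve.
  have key := lintegral_amoebaSector (α := n) (β := m) (y₀ := -(n * Real.log φ))
    (by exact_mod_cast hn) (by exact_mod_cast hm) (by rw [hsp]; ring)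
  have hinv : realL3 (-(φ ^ n)⁻¹) = realL3 (-φ ^ n) := by
    rw [← inv_neg]
    exact realL3_inv_of_neg (by linarith)
  rwa [hexp, hsum, hinv] at key

lemma lintegral_amoebaSector_root_add {m n : ℕ} (hm : 1 ≤ m) (hn : 1 ≤ n) {φ : ℝ} (h0 : 0 ≤ φ)
    (h : φ ^ (m + n) + φ ^ n - 1 = 0) :
    0 ≤ m * realL3 (φ ^ n) - n * realL3 (-φ ^ m) ∧
    ∫⁻ p in amoebaSector m n, ENNReal.ofReal (m * p.1 + n * p.2) =
      ENNReal.ofReal (m * realL3 (φ ^ n) - n * realL3 (-φ ^ m)) := by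
  have h0 : 0 < φ := by
    refine h0.lt_of_ne ?_
    rintro rfl
    simp [show n ≠ 0 by omega] at h
  have hm0 : 0 < φ ^ m := by positivity
  have hn0 : 0 < φ ^ n := by positivity
  have hexp : Real.exp (m * Real.log φ) = φ ^ m := by
    rw [← Real.log_pow, Real.exp_log hm0]
  have hsum : 1 + φ ^ m = (φ ^ n)⁻¹ := by
    rw [pow_add] at h
    field_simp
    linarith
  have hsp : softplus (m * Real.log φ) = -(n * Real.log φ) := by
    rw [softplus, hexp, hsum, Real.log_inv, Real.log_pow]
  -- Here the corner is `e^Y = φ^m`, `e^X = φ^(-n)`.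
  have key := lintegral_amoebaSector (α := m) (β := n) (y₀ := m * Real.log φ)
    (by exact_mod_cast hm) (by exact_mod_cast hn) (by rw [hsp]; ring)
  have hinv : realL3 (φ ^ n)⁻¹ = realL3 (φ ^ n) := by
    rw [← realL3_inv_of_one_lt (x := (φ ^ n)⁻¹) (by linarith), inv_inv]
  rwa [hexp, hsum, hinv] at key

lemma mahler_resFun {m n : ℕ} (hm : 1 ≤ m) (hn : 1 ≤ n) {φ₁ φ₂ : ℝ}
    (h₁ : 0 ≤ φ₁) (e₁ : φ₁ ^ (m + n) + φ₁ ^ n - 1 = 0)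
    (h₂ : 1 ≤ φ₂) (e₂ : φ₂ ^ (m + n) - φ₂ ^ n - 1 = 0) :
    IntegrableOn (logAbsOnTorus (resFun m n)) (Set.Icc (0 : Fin 3 → ℝ) 1) ∧
      logMahler (resFun m n) = 2 / Real.pi ^ 2 *
        ((n * realL3 (φ₂ ^ m) - m * realL3 (-φ₂ ^ n)) +
          (m * realL3 (φ₁ ^ n) - n * realL3 (-φ₁ ^ m))) := by
  obtain ⟨p1, i1⟩ := lintegral_amoebaSector_root_add hm hn h₁ e₁
  obtain ⟨p2, i2⟩ := lintegral_amoebaSector_root_sub hm hn h₂ e₂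
  refine logAbsOnTorus_resFun_integral (mul_nonneg (by positivity) (add_nonneg p2 p1)) ?_
  rw [lintegral_posLog_torusQuotient hm hn, lintegral_lineAmoeba (by exact_mod_cast hn)
    (by exact_mod_cast hm), i1, i2, ← ENNReal.ofReal_add p2 p1,
    ← ENNReal.ofReal_mul (by positivity)]

theorem mainTheorem2 (m n : ℕ) (hm : 1 ≤ m) (hn : 1 ≤ n) :
    (∃! φ₁ : ℝ, φ₁ ∈ Set.Icc (0 : ℝ) 1 ∧ φ₁ ^ (m + n) + φ₁ ^ n - 1 = 0) ∧
    (∃! φ₂ : ℝ, φ₂ ∈ Set.Ici (1 : ℝ) ∧ φ₂ ^ (m + n) - φ₂ ^ n - 1 = 0) ∧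
    MeasureTheory.IntegrableOn (logAbsOnTorus (resFun m n)) (Set.Icc (0 : Fin 3 → ℝ) 1) ∧
    ∀ φ₁ φ₂ : ℝ,
      φ₁ ∈ Set.Icc (0 : ℝ) 1 → φ₁ ^ (m + n) + φ₁ ^ n - 1 = 0 →
      φ₂ ∈ Set.Ici (1 : ℝ) → φ₂ ^ (m + n) - φ₂ ^ n - 1 = 0 →
      logMahler (resFun m n) =
        2 * (n : ℝ) / Real.pi ^ 2 *
            (zagierL 3 ((φ₂ ^ m : ℝ) : ℂ) - zagierL 3 ((-(φ₁ ^ m) : ℝ) : ℂ)) +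
          2 * (m : ℝ) / Real.pi ^ 2 *
            (zagierL 3 ((φ₁ ^ n : ℝ) : ℂ) - zagierL 3 ((-(φ₂ ^ n) : ℝ) : ℂ)) := by
  -- Absolute convergence is a by-product of the evaluation, so some pair of roots is needed for it.
  obtain ⟨ψ₁, ⟨hψ₁, eψ₁⟩, -⟩ := existsUnique_root_add (m := m) hn
  obtain ⟨ψ₂, ⟨hψ₂, eψ₂⟩, -⟩ := existsUnique_root_sub hm hn
  refine ⟨existsUnique_root_add hn, existsUnique_root_sub hm hn,
    (mahler_resFun hm hn hψ₁.1 eψ₁ hψ₂ eψ₂).1, fun φ₁ φ₂ h₁ e₁ h₂ e₂ => ?_⟩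
  rw [(mahler_resFun hm hn h₁.1 e₁ h₂ e₂).2]
  simp only [realL3]
  ring
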